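/- Let $L\ge 2$ and let $\alpha_1,\dots,\alpha_{L-1},\beta,\gamma_1,\dots,\gamma_{L-1}$ be complex numbers. Put $\alpha_0=\beta$, $\gamma_0=0$, and extend the indices by $\alpha_{k+L}=\alpha_k+1$, $\gamma_{k+L}=\gamma_k+1$. Assume the non-resonance condition: for $0\le n\le L-1$ and $n<l<n+L$, none of $\alpha_l-\gamma_n$, $\gamma_l-\alpha_l$, $\gamma_l-\gamma_n$ is in $\mathbb Z_{\le 0}$. With $a_m=\alpha_m-\gamma_m$, $b_m=-\gamma_m$ $(0\le m\le L-1)$, let ${\cal P}_{L,1}$ be the system $$\frac{d\boldsymbol y}{dx}=\Big(\frac1x E+\frac1{1-x}F\Big)\boldsymbol y,\qquad E_{mn}=\begin{cases}a_m&(n<m)\\ b_m&(n=m)\\ 0&(n>m)\end{cases},\quad F_{mn}=a_m\qquad(0\le m,n\le L-1).$$ Let $\Delta_0=\{0\le t_{L-1}\le\dots\le t_1\le 1\}\subset\mathbb R^{L-1}$ and, with $t_0=1$, $t_{-1}=x\,t_{L-1}$, $$U(t)=(1-xt_{L-1})^{-\beta}\prod_{k=1}^{L-1}t_k^{\alpha_k-\gamma_{k+1}}(t_{k-1}-t_k)^{\gamma_k-\alpha_k},\qquad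 \varphi_j=\frac{dt_1\wedge\dots\wedge dt_{L-1}}{\prod_{0\le k\le L-1,\,k\ne j}(t_{k-1}-t_k)}\quad(0\le j\le L-1),$$ $\varphi_{j+L}=\varphi_j/x$ for $j\in\mathbb Z$. Let $T_n$ be the parameter shift $\alpha_k\mapsto\alpha_{k+n}-\gamma_n$, $\beta\mapsto\alpha_n-\gamma_n$, $\gamma_k\mapsto\gamma_{k+n}-\gamma_n$, and $U_n=T_n(U)$. For $|x|<1$ and $j\in\mathbb Z$, the integral $\int_{\Delta_0}U\varphi_j$ converges absolutely when $0<\operatorname{Re}\alpha_k<\operatorname{Re}\gamma_k$ for $1\le k\le L-1$, and it continues, uniquely, to a holomorphic function of $(\alpha,\beta,\gamma)$ on the set where no $\alpha_k$ and no $\gamma_k-\alpha_k$ $(1\le k\le L-1)$ is in $\mathbb Z_{\le0}$; this continuation is what the integral means for such parameters. The parameters $T_n(\alpha,\beta,\gamma)$, $0\le n\le L-1$, all lie in this set. Let $$\Phi(x)=\int_{\Delta_0}\big(U_n\varphi_{m-n}\big)_{0\le m,n\le L-1}\qquad(|x|<1).$$ Then $\Phi$ is holomorphic on $|x|<1$,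 $\Phi(x)=(\text{a constant lower triangular matrix})+O(x)$ as $x\to0$, $\Phi(0)$ is invertible, and $$Y(x)=\Phi(x)\,\mathrm{diag}(1,x^{-\gamma_1},\dots,x^{-\gamma_{L-1}})$$ is a fundamental system of solutions of ${\cal P}_{L,1}$: on every connected non-empty open subset of $\{0<|x|<1\}$ carrying a continuous branch of $\log x$, the columns of $Y$, formed with that branch, are a basis of the space of solutions there. -/

import Mathlib

open MeasureTheory Set Topology

namespace Thomae

/-- `pad c v` is the sequence `c, v 0, v 1, …, v (L-2)` (positions `0, …, L-1`), and `0` beyond. -/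
def pad {R : Type*} [Zero R] {L : ℕ} (c : R) (v : Fin (L - 1) → R) (k : ℕ) : R :=
  if k = 0 then c else if h : k - 1 < L - 1 then v ⟨k - 1, h⟩ else 0

/-- The parameters `(α, β, γ)` with `α = (α_1, …, α_{L-1})`, `γ = (γ_1, …, γ_{L-1})`;
the entry with index `k : Fin (L - 1)` is the parameter number `k + 1`. -/
abbrev Params (L : ℕ) : Type := (Fin (L - 1) → ℂ) × ℂ × (Fin (L - 1) → ℂ)

section Parameters

variable {L : ℕ}

/-- `α_k` for `k ≥ 0`: `α_0 = β` and `α_{k+L} = α_k + 1`. -/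
noncomputable def alpha (p : Params L) (k : ℕ) : ℂ :=
  pad p.2.1 p.1 (k % L) + ((k / L : ℕ) : ℂ)

/-- `γ_k` for `k ≥ 0`: `γ_0 = 0` and `γ_{k+L} = γ_k + 1`; in particular `γ_L = 1`. -/
noncomputable def gamma (p : Params L) (k : ℕ) : ℂ :=
  pad 0 p.2.2 (k % L) + ((k / L : ℕ) : ℂ)

/-- The parameter shift `T_n`:
`α_k ↦ α_{k+n} - γ_n`, `β ↦ α_n - γ_n`, `γ_k ↦ γ_{k+n} - γ_n`. -/
noncomputable def shift (n : ℕ) (p : Params L) : Params L :=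
  (fun k => alpha p (k + 1 + n) - gamma p n,
    alpha p n - gamma p n,
    fun k => gamma p (k + 1 + n) - gamma p n)

/-- Non-resonance: for `0 ≤ n ≤ L - 1` and `n < l < n + L`, none of
`α_l - γ_n`, `γ_l - α_l`, `γ_l - γ_n` is a non-positive integer. -/
def NonResonant (p : Params L) : Prop :=
  ∀ n l : ℕ, n < L → n < l → l < n + L → ∀ N : ℕ,
    alpha p l - gamma p n ≠ -(N : ℂ) ∧ gamma p l - alpha p l ≠ -(N : ℂ) ∧
      gamma p l - gamma p n ≠ -(N : ℂ)

end Parameters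

/-- The simplex `Δ_0 = {0 ≤ t_{L-1} ≤ ⋯ ≤ t_2 ≤ t_1 ≤ 1}`. -/
def simplex (L : ℕ) : Set (Fin (L - 1) → ℝ) :=
  {t | (∀ k, 0 ≤ t k ∧ t k ≤ 1) ∧ Antitone t}

section Integrals

variable {L : ℕ}

/-- `U(t) = ∏_{k=1}^{L-1} t_k^{α_k - γ_{k+1}} (t_{k-1} - t_k)^{γ_k - α_k} · (1 - x t_{L-1})^{-β}`,
with `t_0 = 1` and principal powers. For `t ∈ Δ_0` and `|x| < 1` the bases of the first two kinds
are non-negative reals and the last base has positive real part. -/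
noncomputable def U (p : Params L) (x : ℂ) (t : Fin (L - 1) → ℝ) : ℂ :=
  (∏ k ∈ Finset.Icc 1 (L - 1),
      ((pad 1 t k : ℝ) : ℂ) ^ (alpha p k - gamma p (k + 1)) *
        ((pad 1 t (k - 1) - pad 1 t k : ℝ) : ℂ) ^ (gamma p k - alpha p k)) *
    (1 - x * ((pad 1 t (L - 1) : ℝ) : ℂ)) ^ (-p.2.1)

/-- The differences `t_{k-1} - t_k` for `0 ≤ k ≤ L - 1`, with `t_0 = 1` and `t_{-1} = x t_{L-1}`. -/
noncomputable def gap (x : ℂ) (t : Fin (L - 1) → ℝ) (k : ℕ) : ℂ :=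
  if k = 0 then x * ((pad 1 t (L - 1) : ℝ) : ℂ) - 1
  else ((pad 1 t (k - 1) - pad 1 t k : ℝ) : ℂ)

/-- The density of the form `φ_j` (`j ∈ ℤ`) with respect to `dt_1 ∧ ⋯ ∧ dt_{L-1}`:
`φ_j = dt / ∏_{0 ≤ k ≤ L-1, k ≠ j} (t_{k-1} - t_k)` for `0 ≤ j ≤ L - 1`, extended by the
quasi-periodicity `φ_{j+L} = φ_j / x`. -/
noncomputable def phi (x : ℂ) (j : ℤ) (t : Fin (L - 1) → ℝ) : ℂ :=
  x ^ (-(j / (L : ℤ))) / ∏ k ∈ (Finset.range L).erase (j % (L : ℤ)).toNat, gap x t k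

/-- Parameters with `0 < Re α_k < Re γ_k` for all `k`, where `∫_{Δ_0} U φ_j` converges. -/
def convergenceDomain (L : ℕ) : Set (Params L) :=
  {p | ∀ k : Fin (L - 1), 0 < (p.1 k).re ∧ (p.1 k).re < (p.2.2 k).re}

/-- Parameters such that neither `α_k` nor `γ_k - α_k` is a non-positive integer, for all `k`. -/
def regularDomain (L : ℕ) : Set (Params L) :=
  {p | ∀ (k : Fin (L - 1)) (N : ℕ), p.1 k ≠ -(N : ℂ) ∧ p.2.2 k - p.1 k ≠ -(N : ℂ)}

/-- `F` is the continuation of the convergent integrals `p ↦ ∫_{Δ_0} U φ_j` to a holomorphic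
function of the parameters on `regularDomain L`. -/
def IsContinuation (x : ℂ) (j : ℤ) (F : Params L → ℂ) : Prop :=
  DifferentiableOn ℂ F (regularDomain L) ∧
    ∀ p ∈ convergenceDomain L, F p = ∫ t in simplex L, U p x t * phi x j t

open Classical in
/-- The integral `∫_{Δ_0} U φ_j` for parameters in `regularDomain L`, where it is defined by
holomorphic continuation in the parameters (the domain is connected and contains
`convergenceDomain L`, so that the continuation is unique there). -/
noncomputable def eulerIntegral (x : ℂ) (j : ℤ) (p : Params L) : ℂ :=
  if h : ∃ F : Params L → ℂ, IsContinuation x j F then h.choose p else 0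

/-- `Φ(x) = ∫_{Δ_0} (U_n φ_{m-n})_{0 ≤ m, n ≤ L-1}` with `U_n = T_n(U)`. -/
noncomputable def Phi (p : Params L) (x : ℂ) : Matrix (Fin L) (Fin L) ℂ :=
  Matrix.of fun m n => eulerIntegral x ((m : ℤ) - (n : ℤ)) (shift n p)

/-- `Y(x) = Φ(x) diag(1, x^{-γ_1}, …, x^{-γ_{L-1}})`, where `x^c = exp (c * lg x)` for a given
branch `lg` of the logarithm (note `γ_0 = 0`). -/
noncomputable def Y (p : Params L) (lg : ℂ → ℂ) (x : ℂ) : Matrix (Fin L) (Fin L) ℂ :=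
  Phi p x * Matrix.diagonal fun n : Fin L => Complex.exp (-gamma p n * lg x)

end Integrals

section System

variable {L : ℕ}

/-- The coefficient matrix of the system `P_{L,1}`: with `a_m = α_m - γ_m` and `b_m = -γ_m`
(so `a_0 = β`, `b_0 = 0`), the residue part at `0` has `a_m` below the diagonal and `b_m` on the
diagonal of row `m`, and the matrix multiplying `1 / (1 - x)` has all entries of row `m` equal
to `a_m`. -/
noncomputable def coeff (p : Params L) (x : ℂ) : Matrix (Fin L) (Fin L) ℂ :=
  Matrix.of fun m n =>
    1 / x * (if n < m then alpha p m - gamma p m else if n = m then -gamma p m else 0) +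
      1 / (1 - x) * (alpha p m - gamma p m)

/-- `y` solves `dy/dx = A(x) y` on `V`. -/
def IsSolution (A : ℂ → Matrix (Fin L) (Fin L) ℂ) (V : Set ℂ) (y : ℂ → Fin L → ℂ) : Prop :=
  ∀ x ∈ V, HasDerivAt y ((A x).mulVec (y x)) x

/-- The columns of `M` form a basis of the space of solutions of `dy/dx = A(x) y` on `V`. -/
def IsFundamentalSystem (A M : ℂ → Matrix (Fin L) (Fin L) ℂ) (V : Set ℂ) : Prop :=
  (∀ n, IsSolution A V fun x m => M x m n) ∧
    ∀ y, IsSolution A V y → ∃! c : Fin L → ℂ, ∀ x ∈ V, y x = (M x).mulVec c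

end System

end Thomae

/-!
The integrals `∫_{Δ_0} U φ_j` are multiples of hypergeometric series. Integrating out one variable
of the simplex after the other, each step is a beta integral, and monomials in the last variable
are eigenfunctions of it (`integral_chainWeight_pow`). The same recursion bounds the integral of
the absolute value (`exists_lintegral_chainWeight_le`), so that the binomial series of
`(1 - x t_{L-1})^{-β}` may be integrated termwise, and
`∫_{Δ_0} U φ_0 = ∑_i (β)_i / i! ∏_k Γ(γ_k - α_k) Γ(α_k + i) / Γ(γ_k + i) x^i`
(`hyp`, `integral_U_mul_phi_zero`). The forms `φ_j` with `0 < j < L` reduce to `φ_0` by a shift of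
the parameters (`U_mul_phi_of_pos`), and the others by quasi-periodicity.

The series converges locally uniformly on `regularDomain`, where its terms are holomorphic, and so
gives the continuation of the integrals (`isContinuation_eulerValue`). The continuation is unique:
a complex line through a point of the convergence domain meets the complement of `regularDomain`
in a countable set, so the identity theorem applies on it (`eqOn_regularDomain`). Hence the
entries of `Φ` are explicit power series.

With `θ = x d/dx`, row `m` of the system for `y = Φ_{· n} x^{-γ_n}` reads
`(θ + γ_m - γ_n) Φ_{m n} = (α_m - γ_m) R_m`, where
`R_m = ∑_{k < m} Φ_{k n} + x / (1 - x) ∑_k Φ_{k n}`. Since `R_{m+1} - R_m = Φ_{m n}` and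
`R_0 = x R_L`, this is the cyclic system `(θ + γ_m - γ_n) R_{m+1} = (θ + α_m - γ_n) R_m` of
first-order recursions, solved by power series whose coefficients are products of quotients of
Gamma values (`ladder`, `ladder_succ`). That the differences of this solution are the entries of
`Φ` is a contiguity relation (`Phi_eq_sub`).

At `x = 0` the matrix `Φ` is lower triangular, with non-zero products of Gamma values on the
diagonal. By Liouville's formula `det Φ` is a constant multiple of a power of `1 - x`
(`hasDerivAt_det_Phi`), so it vanishes nowhere in the disc, and the columns of `Y` are a basis of
the solutions (`isFundamentalSystem_of_det_ne_zero`).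
-/

namespace Thomae

open Filter

/-! ### Hypergeometric terms and their contiguity relations -/

/-- The Taylor coefficient `(b)_i / i!` of `(1 - z)^{-b}`. -/
noncomputable def binCoeff (b : ℂ) (i : ℕ) : ℂ := ∏ j ∈ Finset.range i, (b + j) / (j + 1)

/-- The value `Γ(c - a) Γ(a + i) / Γ(c + i)` of the beta integral `B(a + i, c - a)`, written so
that it stays holomorphic where `c + i` is a non-positive integer. -/
noncomputable def betaFactor (a c : ℂ) (i : ℕ) : ℂ :=
  Complex.Gamma (c - a) * Complex.Gamma (a + i) * (Complex.Gamma (c + i))⁻¹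

theorem binCoeff_succ (b : ℂ) (i : ℕ) :
    binCoeff b (i + 1) = binCoeff b i * ((b + i) / (i + 1)) := by
  simp only [binCoeff, Finset.prod_range_succ]

theorem mul_binCoeff_add_one (b : ℂ) (i : ℕ) :
    b * binCoeff (b + 1) i = (b + i) * binCoeff b i := by
  induction i with
  | zero => simp [binCoeff]
  | succ i ih =>
    rw [binCoeff_succ, binCoeff_succ, ← mul_assoc, ih]
    push_cast
    ring

theorem succ_mul_binCoeff (b : ℂ) (i : ℕ) :
    ((i : ℂ) + 1) * binCoeff b (i + 1) = (b + i) * binCoeff b i := by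
  have : (i : ℂ) + 1 ≠ 0 := Nat.cast_add_one_ne_zero i
  rw [binCoeff_succ]
  field_simp

theorem binCoeff_pascal (b : ℂ) (i : ℕ) :
    binCoeff b (i + 1) = binCoeff (b + 1) (i + 1) - binCoeff (b + 1) i := by
  have h : (i : ℂ) + 1 ≠ 0 := Nat.cast_add_one_ne_zero i
  apply mul_left_cancel₀ h
  rw [mul_sub, succ_mul_binCoeff, succ_mul_binCoeff, ← mul_binCoeff_add_one]
  ring

theorem betaFactor_add_one_add_one (a c : ℂ) (i : ℕ) :
    betaFactor (a + 1) (c + 1) i = betaFactor a c (i + 1) := by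
  simp only [betaFactor]
  push_cast
  ring_nf

theorem mul_inv_Gamma_add_one (s : ℂ) :
    s * (Complex.Gamma (s + 1))⁻¹ = (Complex.Gamma s)⁻¹ :=
  (Complex.one_div_Gamma_eq_self_mul_one_div_Gamma_add_one s).symm

theorem mul_betaFactor_succ {a : ℂ} (c : ℂ) {i : ℕ} (ha : a + i ≠ 0) :
    (c + i) * betaFactor a c (i + 1) = (a + i) * betaFactor a c i := by
  simp only [betaFactor, ← mul_inv_Gamma_add_one (c + i)]
  push_cast
  rw [← add_assoc, ← add_assoc, Complex.Gamma_add_one _ ha]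
  ring

theorem betaFactor_add_one_right {a c : ℂ} {i : ℕ} (ha : a + i ≠ 0) (hc : c - a ≠ 0) :
    betaFactor a (c + 1) i = betaFactor a c i - betaFactor a c (i + 1) := by
  simp only [betaFactor, ← mul_inv_Gamma_add_one (c + i)]
  push_cast
  rw [← add_assoc, ← add_assoc, Complex.Gamma_add_one _ ha, show c + 1 - a = c - a + 1 by ring,
    Complex.Gamma_add_one _ hc, show c + 1 + (i : ℂ) = c + i + 1 by ring]
  ring

section Terms

variable {L : ℕ}

/-- The `i`-th Taylor coefficient at `x = 0` of `∫_{Δ_0} U φ_0`. -/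
noncomputable def hypTerm (q : Params L) (i : ℕ) : ℂ :=
  binCoeff q.2.1 i * ∏ k, betaFactor (q.1 k) (q.2.2 k) i

/-- The parameters `(α_k + [k < j], β + 1, γ_k + [k < j])`, where `k = 1, …, L - 1` numbers the
parameters as in `alpha` and `gamma`. -/
noncomputable def low (j : ℕ) (q : Params L) : Params L :=
  (fun k => q.1 k + if (k : ℕ) + 1 < j then 1 else 0, q.2.1 + 1,
    fun k => q.2.2 k + if (k : ℕ) + 1 < j then 1 else 0)

/-- The parameters `(α_k + [k < j], β + 1, γ_k + [k ≤ j])`, for which `U φ_0` becomes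
`-U φ_j`. -/
noncomputable def raise (j : ℕ) (q : Params L) : Params L :=
  (fun k => q.1 k + if (k : ℕ) + 1 < j then 1 else 0, q.2.1 + 1,
    fun k => q.2.2 k + if (k : ℕ) + 1 ≤ j then 1 else 0)

theorem add_natCast_ne_zero {a : ℂ} (h : ∀ N : ℕ, a ≠ -(N : ℂ)) (i : ℕ) : a + i ≠ 0 :=
  fun h0 => h i (eq_neg_of_add_eq_zero_left h0)

theorem add_one_ne_neg {a : ℂ} (h : ∀ N : ℕ, a ≠ -(N : ℂ)) (N : ℕ) : a + 1 ≠ -(N : ℂ) := by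
  intro h0
  apply h (N + 1)
  push_cast
  linear_combination h0

theorem low_mem_regularDomain (j : ℕ) {q : Params L} (hq : q ∈ regularDomain L) :
    low j q ∈ regularDomain L := by
  intro k N
  have h1 := fun N => (hq k N).1
  have h2 := fun N => (hq k N).2
  simp only [low]
  split_ifs
  · exact ⟨add_one_ne_neg h1 N, by simpa using h2 N⟩
  · exact ⟨by simpa using h1 N, by simpa using h2 N⟩

theorem raise_mem_regularDomain (j : ℕ) {q : Params L} (hq : q ∈ regularDomain L) :
    raise j q ∈ regularDomain L := by
  intro k N
  have h1 := fun N => (hq k N).1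
  have h2 := fun N => (hq k N).2
  have h3 : q.2.2 k + 1 - q.1 k ≠ -(N : ℂ) := by
    rw [show q.2.2 k + 1 - q.1 k = q.2.2 k - q.1 k + 1 by ring]
    exact add_one_ne_neg h2 N
  simp only [raise]
  split_ifs with h h' h'
  · exact ⟨add_one_ne_neg h1 N, by simpa using h2 N⟩
  · omega
  · exact ⟨by simpa using h1 N, by simpa using h3⟩
  · exact ⟨by simpa using h1 N, by simpa using h2 N⟩

/-- The terms for the parameters `low j q`, `low (j + 1) q` and `raise j q` with `j = k + 1` are
products of beta factors that differ only in the factor number `k`. All relations between them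
thus reduce to relations between three beta factors. -/
theorem hypTerm_low_eq (q : Params L) (k : Fin (L - 1)) (i : ℕ) :
    ∃ c : ℂ, hypTerm (low (k + 1) q) i = c * betaFactor (q.1 k) (q.2.2 k) i ∧
      hypTerm (low (k + 1 + 1) q) i = c * betaFactor (q.1 k) (q.2.2 k) (i + 1) ∧
      hypTerm (raise (k + 1) q) i = c * betaFactor (q.1 k) (q.2.2 k + 1) i := by
  refine ⟨binCoeff (q.2.1 + 1) i * ∏ l ∈ Finset.univ.erase k,
    betaFactor ((low (k + 1) q).1 l) ((low (k + 1) q).2.2 l) i, ?_, ?_, ?_⟩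
  · rw [hypTerm, ← Finset.mul_prod_erase _ _ (Finset.mem_univ k)]
    simp only [low, lt_irrefl, if_false, add_zero]
    ring
  · rw [hypTerm, ← Finset.mul_prod_erase _ _ (Finset.mem_univ k)]
    have : ∀ l ∈ Finset.univ.erase k,
        betaFactor ((low (k + 1 + 1) q).1 l) ((low (k + 1 + 1) q).2.2 l) i =
          betaFactor ((low (k + 1) q).1 l) ((low (k + 1) q).2.2 l) i := by
      intro l hl
      have h1 : (l : ℕ) ≠ k := fun h => Finset.ne_of_mem_erase hl (Fin.ext h)
      have h2 : (l : ℕ) + 1 < k + 1 + 1 ↔ (l : ℕ) + 1 < k + 1 := by omega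
      simp only [low, h2]
    rw [Finset.prod_congr rfl this, ← betaFactor_add_one_add_one]
    simp only [low, Nat.lt_succ_self, if_true]
    ring
  · rw [hypTerm, ← Finset.mul_prod_erase _ _ (Finset.mem_univ k)]
    have : ∀ l ∈ Finset.univ.erase k,
        betaFactor ((raise (k + 1) q).1 l) ((raise (k + 1) q).2.2 l) i =
          betaFactor ((low (k + 1) q).1 l) ((low (k + 1) q).2.2 l) i := by
      intro l hl
      have h1 : (l : ℕ) ≠ k := fun h => Finset.ne_of_mem_erase hl (Fin.ext h)
      have h2 : (l : ℕ) + 1 ≤ k + 1 ↔ (l : ℕ) + 1 < k + 1 := by omega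
      simp only [low, raise, h2]
    rw [Finset.prod_congr rfl this]
    simp only [raise, low, lt_irrefl, le_refl, if_true, if_false, add_zero]
    ring

theorem neg_hypTerm_raise {q : Params L} (hq : q ∈ regularDomain L) (k : Fin (L - 1)) (i : ℕ) :
    -hypTerm (raise (k + 1) q) i =
      hypTerm (low (k + 1 + 1) q) i - hypTerm (low (k + 1) q) i := by
  obtain ⟨c, h1, h2, h3⟩ := hypTerm_low_eq q k i
  have hc : q.2.2 k - q.1 k ≠ 0 := by simpa using (hq k 0).2
  rw [h1, h2, h3,
    betaFactor_add_one_right (add_natCast_ne_zero (fun N => (hq k N).1) i) hc]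
  ring

theorem hypTerm_low_succ {q : Params L} (hq : q ∈ regularDomain L) (k : Fin (L - 1)) (i : ℕ) :
    (i + q.2.2 k) * hypTerm (low (k + 1 + 1) q) i =
      (i + q.1 k) * hypTerm (low (k + 1) q) i := by
  obtain ⟨c, h1, h2, -⟩ := hypTerm_low_eq q k i
  have h := mul_betaFactor_succ (q.2.2 k) (add_natCast_ne_zero (fun N => (hq k N).1) i)
  rw [h1, h2]
  linear_combination c * h

theorem hypTerm_low_one (q : Params L) (i : ℕ) :
    hypTerm (low 1 q) i = binCoeff (q.2.1 + 1) i * ∏ k, betaFactor (q.1 k) (q.2.2 k) i := by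
  simp [hypTerm, low]

theorem hypTerm_low_self (q : Params L) (i : ℕ) :
    hypTerm (low L q) i =
      binCoeff (q.2.1 + 1) i * ∏ k, betaFactor (q.1 k) (q.2.2 k) (i + 1) := by
  have (k : Fin (L - 1)) : (k : ℕ) + 1 < L := by omega
  simp only [hypTerm, low, this, if_true, betaFactor_add_one_add_one]

theorem hypTerm_low_one_succ (q : Params L) (i : ℕ) :
    ((i : ℂ) + 1) * hypTerm (low 1 q) (i + 1) = (q.2.1 + 1 + i) * hypTerm (low L q) i := by
  rw [hypTerm_low_one, hypTerm_low_self, ← mul_assoc, succ_mul_binCoeff, mul_assoc]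

theorem hypTerm_succ (q : Params L) (i : ℕ) :
    hypTerm q (i + 1) = hypTerm (low 1 q) (i + 1) - hypTerm (low L q) i := by
  rw [hypTerm_low_one, hypTerm_low_self, hypTerm, binCoeff_pascal]
  ring

theorem hypTerm_zero (q : Params L) : hypTerm q 0 = hypTerm (low 1 q) 0 := by
  rw [hypTerm_low_one, hypTerm]
  simp [binCoeff]

theorem hypTerm_succ_mul {q : Params L} (hq : q ∈ regularDomain L) {i : ℕ}
    (hc : ∀ k, q.2.2 k + i ≠ 0) :
    hypTerm q (i + 1) =
      (q.2.1 + i) / (1 + i) * (∏ k, (q.1 k + i) / (q.2.2 k + i)) * hypTerm q i := by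
  have h (k) : betaFactor (q.1 k) (q.2.2 k) (i + 1) =
      (q.1 k + i) / (q.2.2 k + i) * betaFactor (q.1 k) (q.2.2 k) i := by
    have := mul_betaFactor_succ (q.2.2 k) (add_natCast_ne_zero (fun N => (hq k N).1) i)
    have h0 := hc k
    field_simp
    linear_combination this
  simp only [hypTerm, h, Finset.prod_mul_distrib, binCoeff_succ]
  ring

end Terms

/-! ### Holomorphic dependence of series on parameters -/

/-- A series of holomorphic functions on an open subset of a complex normed space, dominated by a
summable sequence, has a holomorphic sum. In several variables the derivatives of the terms
are controlled by the Schwarz lemma, which replaces Cauchy's estimate. -/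
theorem differentiableAt_tsum_of_summable_norm {E : Type*} [NormedAddCommGroup E]
    [NormedSpace ℂ E] {f : ℕ → E → ℂ} {u : ℕ → ℝ} {c : E} {R : ℝ} (hR : 0 < R) (hu : Summable u)
    (hf : ∀ i, DifferentiableOn ℂ (f i) (Metric.ball c R))
    (hle : ∀ i, ∀ y ∈ Metric.ball c R, ‖f i y‖ ≤ u i) :
    DifferentiableAt ℂ (fun y => ∑' i, f i y) c := by
  have hR2 : 0 < R / 2 := half_pos hR
  let : NormedSpace ℝ E := NormedSpace.restrictScalars ℝ ℂ E
  have hsub (y) (hy : y ∈ Metric.ball c (R / 2)) :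
      Metric.ball y (R / 2) ⊆ Metric.ball c R := by
    apply Metric.ball_subset_ball'
    rw [Metric.mem_ball] at hy
    linarith
  have hcR : Metric.ball c (R / 2) ⊆ Metric.ball c R := Metric.ball_subset_ball (by linarith)
  have hbound (i y) (hy : y ∈ Metric.ball c (R / 2)) :
      ‖fderiv ℂ (f i) y‖ ≤ 2 * u i / (R / 2) := by
    apply Complex.norm_fderiv_le_div_of_mapsTo_ball ((hf i).mono (hsub y hy)) _ hR2
    intro z hz
    have h1 := hle i z (hsub y hy hz)
    have h2 := hle i y (hcR hy)
    rw [Metric.mem_closedBall, dist_eq_norm]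
    linarith [norm_sub_le (f i z) (f i y)]
  have hsum : Summable fun i => 2 * u i / (R / 2) :=
    (hu.mul_left 2).div_const _
  refine (hasFDerivAt_tsum_of_isPreconnected hsum Metric.isOpen_ball
    (convex_ball c (R / 2)).isPreconnected (fun i y hy => ?_) hbound
    (Metric.mem_ball_self hR2) (.of_norm_bounded hu fun i => hle i c (Metric.mem_ball_self hR))
    (Metric.mem_ball_self hR2)).differentiableAt
  exact ((hf i).differentiableAt (Metric.isOpen_ball.mem_nhds (hcR hy))).hasFDerivAt

/-! ### Convergence of the hypergeometric series -/

section

variable {L : ℕ}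

/-- The regular domain is the set where certain values of the entire function `1 / Γ` do not
vanish. -/
theorem isOpen_regularDomain : IsOpen (regularDomain L) := by
  have h : regularDomain L = {q | ∀ k, (Complex.Gamma (q.1 k))⁻¹ ≠ 0 ∧
      (Complex.Gamma (q.2.2 k - q.1 k))⁻¹ ≠ 0} := by
    ext q
    simp only [regularDomain, mem_ofPred_eq, ne_eq, inv_eq_zero, Complex.Gamma_eq_zero_iff,
      not_exists, forall_and]
  have hG := Complex.differentiable_one_div_Gamma.continuous
  rw [h, show {q : Params L | ∀ k, (Complex.Gamma (q.1 k))⁻¹ ≠ 0 ∧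
      (Complex.Gamma (q.2.2 k - q.1 k))⁻¹ ≠ 0} = ⋂ k, {q | (Complex.Gamma (q.1 k))⁻¹ ≠ 0 ∧
      (Complex.Gamma (q.2.2 k - q.1 k))⁻¹ ≠ 0} by ext; simp]
  refine isOpen_iInter_of_finite fun k => IsOpen.inter ?_ ?_
  · exact isOpen_ne_fun (hG.comp (by fun_prop)) continuous_const
  · exact isOpen_ne_fun (hG.comp (by fun_prop)) continuous_const

theorem differentiableAt_hypTerm {q : Params L} (hq : q ∈ regularDomain L) (i : ℕ) :
    DifferentiableAt ℂ (fun q : Params L => hypTerm q i) q := by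
  have h1 : DifferentiableAt ℂ (fun q : Params L => binCoeff q.2.1 i) q := by
    have : DifferentiableAt ℂ (fun b => binCoeff b i) q.2.1 :=
      DifferentiableAt.fun_finsetProd fun j _ => by fun_prop
    exact this.comp q (f := fun q : Params L => q.2.1) (by fun_prop)
  have h2 (k) : DifferentiableAt ℂ (fun q : Params L => betaFactor (q.1 k) (q.2.2 k) i) q := by
    unfold betaFactor
    refine .mul (.mul ?_ ?_) ?_
    · exact (Complex.differentiableAt_Gamma _ fun N => (hq k N).2).comp q
        (f := fun q : Params L => q.2.2 k - q.1 k) (by fun_prop)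
    · refine (Complex.differentiableAt_Gamma (q.1 k + i) fun N h => ?_).comp q
        (f := fun q : Params L => q.1 k + i) (by fun_prop)
      apply (hq k (N + i)).1
      push_cast
      linear_combination h
    · exact (Complex.differentiable_one_div_Gamma _).comp q
        (f := fun q : Params L => q.2.2 k + i) (by fun_prop)
  unfold hypTerm
  exact h1.mul (HasFDerivAt.finsetProd fun k _ => (h2 k).hasFDerivAt).differentiableAt

theorem tendsto_add_natCast_div {α : Type*} {l : Filter (α × ℕ)} {f : α → ℂ} {a : ℂ}
    (hl : Tendsto Prod.snd l atTop) (hf : Tendsto (fun z => f z.1) l (𝓝 a)) :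
    Tendsto (fun z => (f z.1 + z.2) / z.2) l (𝓝 1) := by
  have h1 : Tendsto (fun z : α × ℕ => ((z.2 : ℂ))⁻¹) l (𝓝 0) :=
    tendsto_inv_atTop_nhds_zero_nat.comp hl
  have h2 : Tendsto (fun z => f z.1 * (z.2 : ℂ)⁻¹ + 1) l (𝓝 (a * 0 + 1)) :=
    (hf.mul h1).add_const 1
  rw [mul_zero, zero_add] at h2
  refine h2.congr' ?_
  filter_upwards [hl.eventually_gt_atTop 0] with z hz
  have : (z.2 : ℂ) ≠ 0 := Nat.cast_ne_zero.2 hz.ne'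
  field_simp

/-- Locally uniformly in the parameters, the hypergeometric series is dominated by a summable
sequence: the ratios of successive terms tend to `1`. -/
theorem exists_summable_bound {q₀ : Params L} (hq₀ : q₀ ∈ regularDomain L) {r : ℝ}
    (hr0 : 0 ≤ r) (hr : r < 1) :
    ∃ δ > 0, ∃ u : ℕ → ℝ, Summable u ∧ Metric.ball q₀ δ ⊆ regularDomain L ∧
      ∀ q ∈ Metric.ball q₀ δ, ∀ x : ℂ, ‖x‖ ≤ r → ∀ i, ‖hypTerm q i * x ^ i‖ ≤ u i := by
  obtain ⟨ρ, hρ1, hρr⟩ : ∃ ρ : ℝ, 1 < ρ ∧ ρ * r < 1 := by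
    refine ⟨2 / (1 + r), ?_, ?_⟩
    · rw [lt_div_iff₀ (by linarith)]; linarith
    · rw [div_mul_eq_mul_div, div_lt_one (by linarith)]; linarith
  set l : Filter (Params L × ℕ) := 𝓝 q₀ ×ˢ atTop
  have hl : Tendsto Prod.snd l atTop := tendsto_snd
  have hfst : Tendsto Prod.fst l (𝓝 q₀) := tendsto_fst
  have hlim (f : Params L → ℂ) (hf : Continuous f) :
      Tendsto (fun z : Params L × ℕ => (f z.1 + z.2) / z.2) l (𝓝 1) :=
    tendsto_add_natCast_div hl ((hf.tendsto q₀).comp hfst)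
  have hratio : Tendsto (fun z : Params L × ℕ => (z.1.2.1 + z.2) / z.2 /
      (((fun _ => 1) z.1 + z.2) / z.2) *
      ∏ k, (z.1.1 k + (z.2 : ℂ)) / z.2 / ((z.1.2.2 k + z.2) / z.2)) l
      (𝓝 (1 / 1 * ∏ k : Fin (L - 1), 1 / 1)) := by
    refine ((hlim (fun q => q.2.1) (by fun_prop)).div (hlim (fun _ => 1) (by fun_prop))
      one_ne_zero).mul (tendsto_finsetProd _ fun k _ => ?_)
    exact (hlim (fun q => q.1 k) (by fun_prop)).div (hlim (fun q => q.2.2 k) (by fun_prop))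
      one_ne_zero
  have hev1 := (hratio.norm).eventually_le_const (u := ρ) (by simpa using hρ1)
  have hev2 : ∀ᶠ z in l, ∀ k, (z.1.2.2 k + (z.2 : ℂ)) / z.2 ≠ 0 :=
    eventually_all.2 fun k => (hlim (fun q => q.2.2 k) (by fun_prop)).eventually_ne one_ne_zero
  have hev3 : ∀ᶠ z in l, 0 < z.2 := hl.eventually_gt_atTop 0
  have hev4 : ∀ᶠ z in l, z.1 ∈ regularDomain L :=
    hfst.eventually (isOpen_regularDomain.mem_nhds hq₀)
  have hev : ∀ᶠ z in l, ‖hypTerm z.1 (z.2 + 1)‖ ≤ ρ * ‖hypTerm z.1 z.2‖ := by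
    filter_upwards [hev1, hev2, hev3, hev4] with z h1 h2 h3 h4
    have h3' : (z.2 : ℂ) ≠ 0 := Nat.cast_ne_zero.2 h3.ne'
    rw [hypTerm_succ_mul h4 fun k h => h2 k (by rw [h, zero_div]), norm_mul]
    simp only [div_div_div_cancel_right₀ h3'] at h1
    gcongr
  obtain ⟨P, hP, Q, hQ, hPQ⟩ := Filter.eventually_prod_iff.1 hev
  obtain ⟨i₀, hi₀⟩ := eventually_atTop.1 hQ
  have hcont : ∀ᶠ q in 𝓝 q₀, ∀ i ∈ Finset.range (i₀ + 1),
      ‖hypTerm q i‖ ≤ ‖hypTerm q₀ i‖ + 1 := by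
    rw [Filter.eventually_all_finset]
    intro i _
    exact (differentiableAt_hypTerm hq₀ i).continuousAt.norm.eventually_le_const
      (lt_add_one _)
  obtain ⟨δ, hδ, hball⟩ := Metric.eventually_nhds_iff_ball.1
    ((hP.and hcont).and (isOpen_regularDomain.mem_nhds hq₀))
  set C : ℝ := ∑ i ∈ Finset.range (i₀ + 1), (‖hypTerm q₀ i‖ + 1)
  have hC0 : 0 ≤ C := Finset.sum_nonneg fun _ _ => by positivity
  have hterm (q) (hq : q ∈ Metric.ball q₀ δ) (i : ℕ) : ‖hypTerm q i‖ ≤ C * ρ ^ i := by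
    have hsmall (j : ℕ) (hj : j ≤ i₀) : ‖hypTerm q j‖ ≤ C * ρ ^ j := by
      have hj' : j ∈ Finset.range (i₀ + 1) := Finset.mem_range.2 (by omega)
      calc ‖hypTerm q j‖ ≤ ‖hypTerm q₀ j‖ + 1 := (hball q hq).1.2 j hj'
        _ ≤ C := Finset.single_le_sum (f := fun i => ‖hypTerm q₀ i‖ + 1)
            (fun _ _ => by positivity) hj'
        _ ≤ C * ρ ^ j := le_mul_of_one_le_right hC0 (one_le_pow₀ hρ1.le)
    rcases le_total i i₀ with h | h
    · exact hsmall i h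
    · induction i, h using Nat.le_induction with
      | base => exact hsmall i₀ le_rfl
      | succ j hj ih =>
        calc ‖hypTerm q (j + 1)‖ ≤ ρ * ‖hypTerm q j‖ := hPQ (hball q hq).1.1 (hi₀ j hj)
          _ ≤ ρ * (C * ρ ^ j) := by gcongr
          _ = C * ρ ^ (j + 1) := by ring
  refine ⟨δ, hδ, fun i => C * (ρ * r) ^ i, ?_, fun q hq => (hball q hq).2, ?_⟩
  · exact (summable_geometric_of_lt_one (by positivity) hρr).mul_left C
  · intro q hq x hx i
    calc ‖hypTerm q i * x ^ i‖ = ‖hypTerm q i‖ * ‖x‖ ^ i := by rw [norm_mul, norm_pow]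
      _ ≤ C * ρ ^ i * r ^ i := by gcongr; exact hterm q hq i
      _ = C * (ρ * r) ^ i := by ring

/-- The hypergeometric series `∫_{Δ_0} U φ_0`. -/
noncomputable def hyp (q : Params L) (x : ℂ) : ℂ := ∑' i, hypTerm q i * x ^ i

theorem summable_hypTerm {q : Params L} (hq : q ∈ regularDomain L) {x : ℂ} (hx : ‖x‖ < 1) :
    Summable fun i => hypTerm q i * x ^ i := by
  obtain ⟨δ, hδ, u, hu, -, h⟩ := exists_summable_bound hq (norm_nonneg x) hx
  exact .of_norm_bounded hu (h q (Metric.mem_ball_self hδ) x le_rfl)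

theorem hasSum_hyp {q : Params L} (hq : q ∈ regularDomain L) {x : ℂ} (hx : ‖x‖ < 1) :
    HasSum (fun i => hypTerm q i * x ^ i) (hyp q x) :=
  (summable_hypTerm hq hx).hasSum

theorem differentiableOn_hyp_param {x : ℂ} (hx : ‖x‖ < 1) :
    DifferentiableOn ℂ (fun q : Params L => hyp q x) (regularDomain L) := by
  intro q hq
  obtain ⟨δ, hδ, u, hu, hsub, h⟩ := exists_summable_bound hq (norm_nonneg x) hx
  refine (differentiableAt_tsum_of_summable_norm hδ hu (fun i q' hq' => ?_)
    (fun i q' hq' => h q' hq' x le_rfl i)).differentiableWithinAt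
  exact ((differentiableAt_hypTerm (hsub hq') i).mul_const _).differentiableWithinAt

theorem exists_bound_near {q : Params L} (hq : q ∈ regularDomain L) {x : ℂ} (hx : ‖x‖ < 1) :
    ∃ r, ‖x‖ < r ∧ ∃ u : ℕ → ℝ, Summable u ∧
      ∀ i, ∀ w ∈ Metric.ball (0 : ℂ) r, ‖hypTerm q i * w ^ i‖ ≤ u i := by
  obtain ⟨r, hxr, hr⟩ := exists_between hx
  obtain ⟨δ, hδ, u, hu, -, h⟩ := exists_summable_bound hq ((norm_nonneg x).trans hxr.le) hr
  exact ⟨r, hxr, u, hu, fun i w hw =>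
    h q (Metric.mem_ball_self hδ) w (mem_ball_zero_iff.1 hw).le i⟩

theorem differentiableAt_hyp {q : Params L} (hq : q ∈ regularDomain L) {x : ℂ} (hx : ‖x‖ < 1) :
    DifferentiableAt ℂ (hyp q) x := by
  obtain ⟨r, hxr, u, hu, h⟩ := exists_bound_near hq hx
  exact (Complex.differentiableOn_tsum_of_summable_norm hu (fun i => by fun_prop) Metric.isOpen_ball
    h).differentiableAt (Metric.isOpen_ball.mem_nhds (mem_ball_zero_iff.2 hxr))

/-- The Euler operator `x d/dx` acts on the series termwise. -/
theorem hasSum_mul_deriv_hyp {q : Params L} (hq : q ∈ regularDomain L) {x : ℂ} (hx : ‖x‖ < 1) :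
    HasSum (fun i : ℕ => i * (hypTerm q i * x ^ i)) (x * deriv (hyp q) x) := by
  obtain ⟨r, hxr, u, hu, h⟩ := exists_bound_near hq hx
  have := (Complex.hasSum_deriv_of_summable_norm hu (fun i => by fun_prop) Metric.isOpen_ball
    h (mem_ball_zero_iff.2 hxr)).mul_left x
  refine this.congr_fun fun i => ?_
  rcases i with _ | i
  · simp
  · simp
    ring

theorem hyp_zero (q : Params L) : hyp q 0 = hypTerm q 0 := by
  rw [hyp, tsum_eq_single 0 fun i hi => by simp [hi]]
  simp

/-! ### Contiguity relations for the sums -/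

theorem neg_hyp_raise {q : Params L} (hq : q ∈ regularDomain L) (k : Fin (L - 1)) {x : ℂ}
    (hx : ‖x‖ < 1) :
    -hyp (raise (k + 1) q) x = hyp (low (k + 1 + 1) q) x - hyp (low (k + 1) q) x := by
  refine (hasSum_hyp (raise_mem_regularDomain _ hq) hx).neg.unique ?_
  refine ((hasSum_hyp (low_mem_regularDomain _ hq) hx).sub
    (hasSum_hyp (low_mem_regularDomain _ hq) hx)).congr_fun fun i => ?_
  linear_combination x ^ i * neg_hypTerm_raise hq k i

/-- With `θ = x d/dx`: `(θ + γ_j) hyp (low (j + 1) q) = (θ + α_j) hyp (low j q)`. -/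
theorem hyp_low_succ {q : Params L} (hq : q ∈ regularDomain L) (k : Fin (L - 1)) {x : ℂ}
    (hx : ‖x‖ < 1) :
    x * deriv (hyp (low (k + 1 + 1) q)) x + q.2.2 k * hyp (low (k + 1 + 1) q) x =
      x * deriv (hyp (low (k + 1) q)) x + q.1 k * hyp (low (k + 1) q) x := by
  have h (j : ℕ) (c : ℂ) := (hasSum_mul_deriv_hyp (low_mem_regularDomain j hq) hx).add
    ((hasSum_hyp (low_mem_regularDomain j hq) hx).mul_left c)
  refine (h _ _).unique ((h _ _).congr_fun fun i => ?_)
  linear_combination x ^ i * hypTerm_low_succ hq k i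

theorem hyp_eq_sub {q : Params L} (hq : q ∈ regularDomain L) {x : ℂ} (hx : ‖x‖ < 1) :
    hyp q x = hyp (low 1 q) x - x * hyp (low L q) x := by
  have h1 := hasSum_hyp hq hx
  have h2 := hasSum_hyp (low_mem_regularDomain 1 hq) hx
  have h3 := (hasSum_hyp (low_mem_regularDomain L hq) hx).mul_left x
  rw [← hasSum_nat_add_iff' 1] at h1 h2
  have := h1.unique ((h2.sub h3).congr_fun fun i => ?_)
  · simp only [Finset.sum_range_one, hypTerm_zero q] at this
    linear_combination this
  · rw [hypTerm_succ]
    ring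

/-- With `θ = x d/dx`: `θ hyp (low 1 q) = (θ + β) (x hyp (low L q))`. -/
theorem hyp_low_one {q : Params L} (hq : q ∈ regularDomain L) {x : ℂ} (hx : ‖x‖ < 1) :
    x * deriv (hyp (low 1 q)) x =
      x * (x * deriv (hyp (low L q)) x + (q.2.1 + 1) * hyp (low L q) x) := by
  have h1 := hasSum_mul_deriv_hyp (low_mem_regularDomain 1 hq) hx
  have h2 := hasSum_mul_deriv_hyp (low_mem_regularDomain L hq) hx
  have h3 := hasSum_hyp (low_mem_regularDomain L hq) hx
  rw [← hasSum_nat_add_iff' 1] at h1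
  have := h1.unique (((h2.add (h3.mul_left (q.2.1 + 1))).mul_left x).congr_fun fun i => ?_)
  · simpa using this
  · push_cast
    linear_combination x ^ (i + 1) * hypTerm_low_one_succ q i

end

/-! ### The beta integral -/

/-- The integrand `u^e (s - u)^{d - 1}` of a beta integral over `0 ≤ u ≤ s`, extended by zero.
The second factor is written `(s - u)^d / (s - u)`, the form in which it occurs in `U` times
`phi`, so that no exception is needed where `u = s`. -/
noncomputable def eulerKernel (e d : ℂ) (s u : ℝ) : ℂ :=
  if 0 ≤ u ∧ u ≤ s then (u : ℂ) ^ e * (((s - u : ℝ) : ℂ) ^ d / ((s - u : ℝ) : ℂ)) else 0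

theorem measurable_eulerKernel (e d : ℂ) :
    Measurable fun z : ℝ × ℝ => eulerKernel e d z.1 z.2 := by
  unfold eulerKernel
  refine Measurable.ite ?_ (by fun_prop) measurable_const
  exact (measurableSet_le measurable_const measurable_snd).inter
    (measurableSet_le measurable_snd measurable_fst)

theorem eulerKernel_ae_eq (e d : ℂ) (s : ℝ) :
    eulerKernel e d s =ᵐ[volume]
      (Ioc 0 s).indicator fun u : ℝ => (u : ℂ) ^ e * ((s : ℂ) - u) ^ (d - 1) := by
  filter_upwards [Measure.ae_ne volume 0, Measure.ae_ne volume s] with u h0 hs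
  by_cases h : 0 ≤ u ∧ u ≤ s
  · have hsu : ((s - u : ℝ) : ℂ) ≠ 0 := Complex.ofReal_ne_zero.2 (sub_ne_zero.2 hs.symm)
    rw [eulerKernel, if_pos h,
      indicator_of_mem (show u ∈ Ioc 0 s from ⟨lt_of_le_of_ne h.1 h0.symm, h.2⟩),
      Complex.cpow_sub d 1 (Complex.ofReal_sub s u ▸ hsu), Complex.cpow_one]
    push_cast
    rfl
  · rw [eulerKernel, if_neg h, indicator_of_notMem fun h' => h ⟨h'.1.le, h'.2⟩]

theorem integral_eulerKernel {a d : ℂ} (ha : 0 < a.re) (hd : 0 < d.re) {s : ℝ} (hs : 0 < s) :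
    ∫ u, eulerKernel (a - 1) d s u =
      (s : ℂ) ^ (a + d - 1) * (Complex.Gamma a * Complex.Gamma d / Complex.Gamma (a + d)) := by
  rw [integral_congr_ae (eulerKernel_ae_eq _ _ _), integral_indicator measurableSet_Ioc,
    ← intervalIntegral.integral_of_le hs.le, Complex.betaIntegral_scaled a d hs,
    Complex.betaIntegral_eq_Gamma_mul_div a d ha hd]

theorem norm_eulerKernel (e d : ℂ) {s u : ℝ} (hu : 0 < u) (hus : u < s) :
    ((‖eulerKernel e d s u‖ : ℝ) : ℂ) = eulerKernel (e.re : ℂ) (d.re : ℂ) s u := by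
  have hs : 0 < s - u := sub_pos.2 hus
  rw [eulerKernel, eulerKernel, if_pos ⟨hu.le, hus.le⟩, if_pos ⟨hu.le, hus.le⟩, norm_mul, norm_div,
    Complex.norm_cpow_eq_rpow_re_of_pos hu, Complex.norm_cpow_eq_rpow_re_of_pos hs,
    Complex.norm_real, Real.norm_of_nonneg hs.le]
  push_cast
  rw [Complex.ofReal_cpow hu.le, Complex.ofReal_cpow hs.le]
  push_cast
  rfl

/-- The beta integral converges absolutely; the value with real exponents bounds the integral
of the norm. -/
theorem exists_lintegral_eulerKernel_le {a d : ℂ} (ha : 0 < a.re) (hd : 0 < d.re) :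
    ∃ C : NNReal, ∀ s : ℝ, 0 < s →
      ∫⁻ u, ‖eulerKernel (a - 1) d s u‖ₑ ≤ C * ‖(s : ℂ) ^ (a + d - 1)‖ₑ := by
  have ha' : 0 < ((a.re : ℝ) : ℂ).re := ha
  have hd' : 0 < ((d.re : ℝ) : ℂ).re := hd
  set B : ℂ := Complex.Gamma (a.re : ℂ) * Complex.Gamma (d.re : ℂ) /
    Complex.Gamma ((a.re : ℂ) + (d.re : ℂ))
  refine ⟨‖B‖₊, fun s hs => ?_⟩
  have hs0 : (s : ℂ) ≠ 0 := Complex.ofReal_ne_zero.2 hs.ne'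
  have hae : ∀ᵐ u : ℝ, eulerKernel ((a.re : ℂ) - 1) (d.re : ℂ) s u =
      ((‖eulerKernel (a - 1) d s u‖ : ℝ) : ℂ) := by
    filter_upwards [Measure.ae_ne volume 0, Measure.ae_ne volume s] with u h0 hs
    by_cases h : 0 ≤ u ∧ u ≤ s
    · rw [norm_eulerKernel _ _ (lt_of_le_of_ne h.1 h0.symm) (lt_of_le_of_ne h.2 hs)]
      simp
    · simp [eulerKernel, if_neg h]
  have hval := integral_eulerKernel ha' hd' hs
  have hne : ∫ u, eulerKernel ((a.re : ℂ) - 1) (d.re : ℂ) s u ≠ 0 := by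
    rw [hval]
    refine mul_ne_zero (by simp [Complex.cpow_eq_zero_iff, hs0])
      (div_ne_zero (mul_ne_zero ?_ ?_) ?_)
    · exact Complex.Gamma_ne_zero_of_re_pos ha'
    · exact Complex.Gamma_ne_zero_of_re_pos hd'
    · exact Complex.Gamma_ne_zero_of_re_pos (add_pos ha' hd')
  -- A Bochner integral with non-zero value is that of an integrable function.
  have hint : Integrable (eulerKernel ((a.re : ℂ) - 1) (d.re : ℂ) s) :=
    Classical.not_not.1 fun h => hne (integral_undef h)
  have hint' : Integrable fun u => ‖eulerKernel (a - 1) d s u‖ := by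
    refine hint.norm.congr ?_
    filter_upwards [hae] with u hu
    rw [hu]
    simp
  rw [integral_congr_ae hae, integral_complex_ofReal] at hval
  have hnn : 0 ≤ ∫ u, ‖eulerKernel (a - 1) d s u‖ := integral_nonneg fun _ => norm_nonneg _
  calc ∫⁻ u, ‖eulerKernel (a - 1) d s u‖ₑ
      = ENNReal.ofReal (∫ u, ‖eulerKernel (a - 1) d s u‖) := by
        rw [ofReal_integral_eq_lintegral_ofReal hint' (ae_of_all _ fun _ => norm_nonneg _)]
        simp only [ofReal_norm]
    _ = ‖((∫ u, ‖eulerKernel (a - 1) d s u‖ : ℝ) : ℂ)‖ₑ := by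
        rw [← ofReal_norm, Complex.norm_real, Real.norm_of_nonneg hnn]
    _ = ‖B‖₊ * ‖(s : ℂ) ^ (a + d - 1)‖ₑ := by
        rw [hval, enorm_mul, mul_comm, ← ofReal_norm ((s : ℂ) ^ _), ← ofReal_norm ((s : ℂ) ^ _),
          Complex.norm_cpow_eq_rpow_re_of_pos hs, Complex.norm_cpow_eq_rpow_re_of_pos hs]
        simp [enorm_eq_nnnorm, B]
    _ ≤ _ := le_rfl

/-! ### Iterated beta integrals over the simplex -/

/-- The product of the kernels `t_k^{α_k - γ_{k+1}} (t_{k-1} - t_k)^{γ_k - α_k - 1}`,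
`0 ≤ k ≤ N - 1`, with `t_{-1} = s`, on the chain `s ≥ t_0 ≥ ⋯ ≥ t_{N-1} ≥ 0`, and zero off it.
The indices start at `0`, so that the recursion shifts the parameter sequences by one. -/
noncomputable def chainWeight : (N : ℕ) → (α γ : ℕ → ℂ) → ℝ → (Fin N → ℝ) → ℂ
  | 0, _, _, _, _ => 1
  | N + 1, α, γ, s, t => eulerKernel (α 0 - γ 1) (γ 0 - α 0) s (t 0) *
      chainWeight N (fun k => α (k + 1)) (fun k => γ (k + 1)) (t 0) (Fin.tail t)

theorem pad_cons_succ {N : ℕ} (s : ℝ) (t : Fin (N + 1) → ℝ) (k : ℕ) :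
    pad (L := N + 2) s t (k + 1) = pad (L := N + 1) (t 0) (Fin.tail t) k := by
  rcases k with _ | k
  · simp [pad]
  · simp [pad, Fin.tail]

theorem measurable_pad {N : ℕ} (k : ℕ) :
    Measurable fun z : ℝ × (Fin N → ℝ) => pad (L := N + 1) z.1 z.2 k := by
  unfold pad
  split_ifs
  · exact measurable_fst
  · exact (measurable_pi_apply _).comp measurable_snd
  · exact measurable_const

theorem measurable_tail {N : ℕ} : Measurable (Fin.tail : (Fin (N + 1) → ℝ) → Fin N → ℝ) :=
  measurable_pi_lambda _ fun _ => measurable_pi_apply _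

theorem measurable_chainWeight {N : ℕ} (α γ : ℕ → ℂ) :
    Measurable fun z : ℝ × (Fin N → ℝ) => chainWeight N α γ z.1 z.2 := by
  induction N generalizing α γ with
  | zero => simp only [chainWeight]; exact measurable_const
  | succ N ih =>
    simp only [chainWeight]
    have h0 : Measurable fun z : ℝ × (Fin (N + 1) → ℝ) => z.2 0 :=
      (measurable_pi_apply _).comp measurable_snd
    exact ((measurable_eulerKernel _ _).comp (measurable_fst.prodMk h0)).mul
      ((ih _ _).comp (h0.prodMk (measurable_tail.comp measurable_snd)))

theorem lintegral_fin_succ {N : ℕ} {F : ℝ → (Fin N → ℝ) → ENNReal}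
    (hF : Measurable (Function.uncurry F)) :
    ∫⁻ t : Fin (N + 1) → ℝ, F (t 0) (Fin.tail t) = ∫⁻ u, ∫⁻ v, F u v := by
  have h := (volume_preserving_piFinSuccAbove (fun _ : Fin (N + 1) => ℝ) 0).lintegral_comp hF
  rw [Measure.volume_eq_prod, lintegral_prod _ hF.aemeasurable] at h
  exact h

theorem integral_fin_succ {N : ℕ} {F : ℝ → (Fin N → ℝ) → ℂ}
    (hF : Integrable fun t : Fin (N + 1) → ℝ => F (t 0) (Fin.tail t)) :
    ∫ t : Fin (N + 1) → ℝ, F (t 0) (Fin.tail t) = ∫ u, ∫ v, F u v := by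
  have hm := volume_preserving_piFinSuccAbove (fun _ : Fin (N + 1) => ℝ) 0
  have he := (MeasurableEquiv.piFinSuccAbove (fun _ : Fin (N + 1) => ℝ) 0).measurableEmbedding
  have h := hm.integral_comp he (Function.uncurry F)
  have hi : Integrable (Function.uncurry F) := (hm.integrable_comp_emb he).1 hF
  rw [Measure.volume_eq_prod, integral_prod _ hi] at h
  exact h

/-- The exponents of consecutive variables combine: multiplication by `u^{γ - 1}` turns the kernel
with exponent `α - γ` into the kernel with exponent `α - 1`. -/
theorem eulerKernel_mul_cpow (a c d : ℂ) (s : ℝ) {u : ℝ} (hu : u ≠ 0) :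
    eulerKernel (a - c) d s u * (u : ℂ) ^ (c - 1) = eulerKernel (a - 1) d s u := by
  unfold eulerKernel
  have hu' : (u : ℂ) ≠ 0 := Complex.ofReal_ne_zero.2 hu
  split_ifs
  · rw [show a - 1 = (a - c) + (c - 1) by ring, Complex.cpow_add _ _ hu']
    ring
  · simp

/-- Absolute convergence of the iterated integrals, uniformly in the bounded factor `g`. -/
theorem exists_lintegral_chainWeight_le {N : ℕ} {α γ : ℕ → ℂ}
    (h : ∀ k < N, 0 < (α k).re ∧ (α k).re < (γ k).re) (hγ : γ N = 1) :
    ∃ C : NNReal, ∀ (g : ℝ → ℂ) (M : NNReal), Measurable g → (∀ u ∈ Icc (0 : ℝ) 1, ‖g u‖ₑ ≤ M) →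
      ∀ s ∈ Ioc (0 : ℝ) 1, ∫⁻ t, ‖chainWeight N α γ s t * g (pad (L := N + 1) s t N)‖ₑ ≤
        C * M * ‖(s : ℂ) ^ (γ 0 - 1)‖ₑ := by
  induction N generalizing α γ with
  | zero =>
    refine ⟨1, fun g M _ hM s hs => ?_⟩
    have := hM s ⟨hs.1.le, hs.2⟩
    rw [Measure.volume_pi_eq_dirac]
    simpa [chainWeight, pad, hγ] using this
  | succ N ih =>
    obtain ⟨C, hC⟩ := ih (α := fun k => α (k + 1)) (γ := fun k => γ (k + 1))
      (fun k hk => h (k + 1) (by omega)) hγ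
    have h0 := h 0 (by omega)
    obtain ⟨B, hB⟩ := exists_lintegral_eulerKernel_le (a := α 0) (d := γ 0 - α 0) h0.1
      (by simpa using h0.2)
    refine ⟨C * B, fun g M hg hM s hs => ?_⟩
    set W : ℝ → (Fin N → ℝ) → ℂ := fun u v =>
      chainWeight N (fun k => α (k + 1)) (fun k => γ (k + 1)) u v * g (pad (L := N + 1) u v N)
    have hW : Measurable (Function.uncurry W) :=
      (measurable_chainWeight _ _).mul (hg.comp (measurable_pad _))
    have hK : Measurable (eulerKernel (α 0 - γ 1) (γ 0 - α 0) s) :=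
      (measurable_eulerKernel _ _).comp (measurable_const.prodMk measurable_id)
    calc ∫⁻ t : Fin (N + 1) → ℝ,
          ‖chainWeight (N + 1) α γ s t * g (pad (L := N + 2) s t (N + 1))‖ₑ
        = ∫⁻ t : Fin (N + 1) → ℝ, ‖eulerKernel (α 0 - γ 1) (γ 0 - α 0) s (t 0)‖ₑ *
            ‖W (t 0) (Fin.tail t)‖ₑ := by
          refine lintegral_congr fun t => ?_
          rw [chainWeight, pad_cons_succ, mul_assoc, enorm_mul]
      _ = ∫⁻ u, ∫⁻ v, ‖eulerKernel (α 0 - γ 1) (γ 0 - α 0) s u‖ₑ * ‖W u v‖ₑ :=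
          lintegral_fin_succ (F := fun u v =>
            ‖eulerKernel (α 0 - γ 1) (γ 0 - α 0) s u‖ₑ * ‖W u v‖ₑ)
            ((hK.comp measurable_fst).enorm.mul hW.enorm)
      _ = ∫⁻ u, ‖eulerKernel (α 0 - γ 1) (γ 0 - α 0) s u‖ₑ * ∫⁻ v, ‖W u v‖ₑ := by
          refine lintegral_congr fun u => lintegral_const_mul _ ?_
          exact (hW.comp measurable_prodMk_left).enorm
      _ ≤ ∫⁻ u, C * M * ‖eulerKernel (α 0 - 1) (γ 0 - α 0) s u‖ₑ := by
          refine lintegral_mono_ae ?_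
          filter_upwards [Measure.ae_ne volume 0] with u hu
          by_cases hus : 0 ≤ u ∧ u ≤ s
          · have := hC g M hg hM u ⟨lt_of_le_of_ne hus.1 hu.symm, hus.2.trans hs.2⟩
            calc _ ≤ ‖eulerKernel (α 0 - γ 1) (γ 0 - α 0) s u‖ₑ *
                  (C * M * ‖(u : ℂ) ^ (γ 1 - 1)‖ₑ) := by gcongr
              _ = C * M * ‖eulerKernel (α 0 - γ 1) (γ 0 - α 0) s u * (u : ℂ) ^ (γ 1 - 1)‖ₑ := by
                  rw [enorm_mul]
                  ring
              _ = _ := by rw [eulerKernel_mul_cpow _ _ _ _ hu]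
          · simp [eulerKernel, if_neg hus]
      _ = C * M * ∫⁻ u, ‖eulerKernel (α 0 - 1) (γ 0 - α 0) s u‖ₑ := by
          refine lintegral_const_mul _ ?_
          exact ((measurable_eulerKernel _ _).comp (measurable_const.prodMk measurable_id)).enorm
      _ ≤ C * M * (B * ‖(s : ℂ) ^ (α 0 + (γ 0 - α 0) - 1)‖ₑ) := by
          gcongr
          exact hB s hs.1
      _ = _ := by
          rw [add_sub_cancel]
          push_cast
          ring

theorem integrable_chainWeight {N : ℕ} {α γ : ℕ → ℂ}
    (h : ∀ k < N, 0 < (α k).re ∧ (α k).re < (γ k).re) (hγ : γ N = 1) {g : ℝ → ℂ} {M : NNReal}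
    (hg : Measurable g) (hM : ∀ u ∈ Icc (0 : ℝ) 1, ‖g u‖ₑ ≤ M) {s : ℝ} (hs : s ∈ Ioc (0 : ℝ) 1) :
    Integrable fun t => chainWeight N α γ s t * g (pad (L := N + 1) s t N) := by
  obtain ⟨C, hC⟩ := exists_lintegral_chainWeight_le h hγ
  have hm : Measurable fun t : Fin N → ℝ =>
      chainWeight N α γ s t * g (pad (L := N + 1) s t N) :=
    ((measurable_chainWeight α γ).mul (hg.comp (measurable_pad N))).comp
      (measurable_const.prodMk measurable_id)
  refine ⟨hm.aestronglyMeasurable, (hC g M hg hM s hs).trans_lt ?_⟩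
  exact ENNReal.mul_lt_top (ENNReal.mul_lt_top (by simp) (by simp)) (by simp)

theorem enorm_pow_le_one (i : ℕ) (u : ℝ) (hu : u ∈ Icc (0 : ℝ) 1) :
    ‖(u : ℂ) ^ i‖ₑ ≤ ((1 : NNReal) : ENNReal) := by
  rw [← ofReal_norm, norm_pow, Complex.norm_real, Real.norm_of_nonneg hu.1]
  simpa using pow_le_one₀ hu.1 hu.2

/-- Monomials are eigenfunctions of the integral operators given by the kernels; the eigenvalues
are values of the beta function. -/
theorem integral_chainWeight_pow {N : ℕ} {α γ : ℕ → ℂ}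
    (h : ∀ k < N, 0 < (α k).re ∧ (α k).re < (γ k).re) (hγ : γ N = 1) (i : ℕ) {s : ℝ}
    (hs : s ∈ Ioc (0 : ℝ) 1) :
    ∫ t, chainWeight N α γ s t * ((pad (L := N + 1) s t N : ℝ) : ℂ) ^ i =
      (s : ℂ) ^ (γ 0 + i - 1) * ∏ k ∈ Finset.range N, betaFactor (α k) (γ k) i := by
  have hpow : Measurable fun u : ℝ => (u : ℂ) ^ i := by fun_prop
  induction N generalizing α γ s with
  | zero =>
    rw [Measure.volume_pi_eq_dirac]
    simp [chainWeight, pad, hγ]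
  | succ N ih =>
    have hi := integrable_chainWeight h hγ hpow (enorm_pow_le_one i) hs
    set W : ℝ → (Fin N → ℝ) → ℂ := fun u v =>
      chainWeight N (fun k => α (k + 1)) (fun k => γ (k + 1)) u v *
        ((pad (L := N + 1) u v N : ℝ) : ℂ) ^ i
    have heq (t : Fin (N + 1) → ℝ) : chainWeight (N + 1) α γ s t *
        ((pad (L := N + 2) s t (N + 1) : ℝ) : ℂ) ^ i =
        eulerKernel (α 0 - γ 1) (γ 0 - α 0) s (t 0) * W (t 0) (Fin.tail t) := by
      rw [chainWeight, pad_cons_succ, mul_assoc]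
    have h0 := h 0 (by omega)
    set P := ∏ k ∈ Finset.range N, betaFactor (α (k + 1)) (γ (k + 1)) i
    calc ∫ t : Fin (N + 1) → ℝ, chainWeight (N + 1) α γ s t *
          ((pad (L := N + 2) s t (N + 1) : ℝ) : ℂ) ^ i
        = ∫ t : Fin (N + 1) → ℝ,
            eulerKernel (α 0 - γ 1) (γ 0 - α 0) s (t 0) * W (t 0) (Fin.tail t) :=
          integral_congr_ae (ae_of_all _ heq)
      _ = ∫ u, ∫ v, eulerKernel (α 0 - γ 1) (γ 0 - α 0) s u * W u v := by
          refine integral_fin_succ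
            (F := fun u v => eulerKernel (α 0 - γ 1) (γ 0 - α 0) s u * W u v) ?_
          exact hi.congr (ae_of_all _ heq)
      _ = ∫ u, eulerKernel (α 0 + i - 1) (γ 0 - α 0) s u * P := by
          refine integral_congr_ae ?_
          filter_upwards [Measure.ae_ne volume 0] with u hu
          rw [integral_const_mul]
          by_cases hus : 0 ≤ u ∧ u ≤ s
          · rw [ih (α := fun k => α (k + 1)) (γ := fun k => γ (k + 1))
              (fun k hk => h (k + 1) (by omega)) hγ
              ⟨lt_of_le_of_ne hus.1 hu.symm, hus.2.trans hs.2⟩, ← mul_assoc]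
            rw [← eulerKernel_mul_cpow (α 0 + i) (γ 1 + i) _ _ hu, add_sub_add_right_eq_sub]
          · simp [eulerKernel, if_neg hus]
      _ = (s : ℂ) ^ (γ 0 + i - 1) * (betaFactor (α 0) (γ 0) i * P) := by
          have h1 : 0 < (α 0 + i).re := by
            simpa using add_pos_of_pos_of_nonneg h0.1 (Nat.cast_nonneg i)
          rw [integral_mul_const, integral_eulerKernel h1 (by simpa using h0.2) hs.1,
            show α 0 + i + (γ 0 - α 0) = γ 0 + i by ring, betaFactor]
          ring
      _ = _ := by rw [Finset.prod_range_succ']; ring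

/-! ### The binomial series -/

theorem multichoose_eq_binCoeff (b : ℂ) (i : ℕ) : Ring.multichoose b i = binCoeff b i := by
  have h (i : ℕ) : ((i.factorial : ℕ) : ℂ) * binCoeff b i = (ascPochhammer ℂ i).eval b := by
    induction i with
    | zero => simp [binCoeff]
    | succ i ih =>
      rw [ascPochhammer_succ_eval, ← ih, Nat.factorial_succ]
      push_cast
      linear_combination (i.factorial : ℂ) * succ_mul_binCoeff b i
  have h0 : ((i.factorial : ℕ) : ℂ) ≠ 0 := Nat.cast_ne_zero.2 i.factorial_ne_zero
  apply mul_left_cancel₀ h0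
  rw [h, ← nsmul_eq_mul, Ring.factorial_nsmul_multichoose_eq_ascPochhammer,
    Polynomial.ascPochhammer_smeval_eq_eval]

theorem hasSum_binCoeff (b : ℂ) {z : ℂ} (hz : ‖z‖ < 1) :
    HasSum (fun i => binCoeff b i * z ^ i) ((1 - z) ^ (-b)) := by
  have h := (Complex.one_div_one_sub_cpow_hasFPowerSeriesOnBall_zero b).hasSum (y := z)
    (by simpa [enorm_eq_nnnorm, ← NNReal.coe_lt_one] using hz)
  simpa [← Ring.multichoose_eq, multichoose_eq_binCoeff, mul_comm, Complex.cpow_neg] using h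

theorem summable_norm_binCoeff (b : ℂ) {z : ℂ} (hz : ‖z‖ < 1) :
    Summable fun i => ‖binCoeff b i * z ^ i‖ :=
  (hasSum_binCoeff b hz).summable.norm

/-! ### The Euler integrals in their domain of convergence -/

theorem chain_succ_iff {N : ℕ} (s : ℝ) (t : Fin (N + 1) → ℝ) :
    ((∀ k, 0 ≤ t k ∧ t k ≤ s) ∧ Antitone t) ↔ (0 ≤ t 0 ∧ t 0 ≤ s) ∧
      ((∀ k, 0 ≤ Fin.tail t k ∧ Fin.tail t k ≤ t 0) ∧ Antitone (Fin.tail t)) := by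
  constructor
  · rintro ⟨h, ht⟩
    exact ⟨h 0, fun k => ⟨(h k.succ).1, ht (Fin.zero_le _)⟩,
      fun i j hij => ht (Fin.succ_le_succ_iff.2 hij)⟩
  · rintro ⟨h0, h, ht⟩
    refine ⟨fun k => ?_, fun i j hij => ?_⟩
    · cases k using Fin.cases with
      | zero => exact h0
      | succ k => exact ⟨(h k).1, (h k).2.trans h0.2⟩
    · cases j using Fin.cases with
      | zero => rw [Fin.le_zero_iff.1 hij]
      | succ j =>
        cases i using Fin.cases with
        | zero => exact (h j).2
        | succ i => exact ht (Fin.succ_le_succ_iff.1 hij)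

open Classical in
theorem chainWeight_eq {N : ℕ} (α γ : ℕ → ℂ) (s : ℝ) (t : Fin N → ℝ) :
    chainWeight N α γ s t = if (∀ k, 0 ≤ t k ∧ t k ≤ s) ∧ Antitone t then
      ∏ k ∈ Finset.range N, (((pad (L := N + 1) s t (k + 1) : ℝ) : ℂ) ^ (α k - γ (k + 1)) *
        (((pad (L := N + 1) s t k - pad (L := N + 1) s t (k + 1) : ℝ) : ℂ) ^ (γ k - α k) /
          ((pad (L := N + 1) s t k - pad (L := N + 1) s t (k + 1) : ℝ) : ℂ))) else 0 := by
  induction N generalizing α γ s with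
  | zero => simp [chainWeight, Subsingleton.antitone]
  | succ N ih =>
    rw [chainWeight, ih, eulerKernel, if_congr (chain_succ_iff s t) rfl rfl,
      Finset.prod_range_succ']
    simp only [pad_cons_succ]
    by_cases h1 : 0 ≤ t 0 ∧ t 0 ≤ s
    · rw [if_pos h1]
      by_cases h2 : (∀ k, 0 ≤ Fin.tail t k ∧ Fin.tail t k ≤ t 0) ∧ Antitone (Fin.tail t)
      · rw [if_pos h2, if_pos ⟨h1, h2⟩, mul_comm]
        rfl
      · rw [if_neg h2, if_neg fun h => h2 h.2, mul_zero]
    · rw [if_neg h1, if_neg fun h : (0 ≤ t 0 ∧ t 0 ≤ s) ∧ _ => h1 h.1, zero_mul]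

theorem prod_Icc_one {M : Type*} [CommMonoid M] (f : ℕ → M) (N : ℕ) :
    ∏ k ∈ Finset.Icc 1 N, f k = ∏ k ∈ Finset.range N, f (k + 1) := by
  rw [Finset.range_eq_Ico, Finset.prod_Ico_add' f 0 N 1]
  rfl

section

variable {N : ℕ}

theorem alpha_add_one (p : Params (N + 1)) (k : Fin N) : alpha p (k + 1) = p.1 k := by
  have h : (k : ℕ) + 1 < N + 1 := by omega
  simp [alpha, pad, Nat.mod_eq_of_lt h, Nat.div_eq_of_lt h]

theorem gamma_add_one (p : Params (N + 1)) (k : Fin N) : gamma p (k + 1) = p.2.2 k := by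
  have h : (k : ℕ) + 1 < N + 1 := by omega
  simp [gamma, pad, Nat.mod_eq_of_lt h, Nat.div_eq_of_lt h]

theorem gamma_self (p : Params (N + 1)) : gamma p (N + 1) = 1 := by
  simp [gamma, pad]

theorem measurableSet_simplex : MeasurableSet (simplex (N + 1)) := by
  have : simplex (N + 1) = (⋂ k, {t | 0 ≤ t k ∧ t k ≤ 1}) ∩ {t | Antitone t} := by
    ext t
    simp [simplex]
  rw [this]
  refine (MeasurableSet.iInter fun k => ?_).inter isClosed_antitone.measurableSet
  exact (measurableSet_le measurable_const (measurable_pi_apply _)).inter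
    (measurableSet_le (measurable_pi_apply _) measurable_const)

theorem pad_mem_Icc {t : Fin N → ℝ} (ht : t ∈ simplex (N + 1)) (k : ℕ) :
    pad (L := N + 1) 1 t k ∈ Icc (0 : ℝ) 1 := by
  unfold pad
  split_ifs
  · simp
  · exact ht.1 _
  · simp

theorem norm_mul_ofReal_lt_one {x : ℂ} (hx : ‖x‖ < 1) {u : ℝ} (hu : u ∈ Icc (0 : ℝ) 1) :
    ‖x * (u : ℂ)‖ < 1 := by
  rw [norm_mul, Complex.norm_real, Real.norm_of_nonneg hu.1]
  exact (mul_le_of_le_one_right (norm_nonneg x) hu.2).trans_lt hx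

theorem one_sub_ne_zero_of_norm_lt_one {z : ℂ} (hz : ‖z‖ < 1) : 1 - z ≠ 0 := by
  intro h
  rw [← sub_eq_zero.1 h, norm_one] at hz
  exact lt_irrefl _ hz

/-- The integrand of `∫_{Δ_0} U φ_0` as an iterated beta integrand. -/
theorem indicator_U_mul_phi_zero (p : Params (N + 1)) {x : ℂ} (hx : ‖x‖ < 1) (t : Fin N → ℝ) :
    (simplex (N + 1)).indicator (fun t => U p x t * phi x 0 t) t =
      chainWeight N (fun k => alpha p (k + 1)) (fun k => gamma p (k + 1)) 1 t *
        (1 - x * ((pad (L := N + 1) 1 t N : ℝ) : ℂ)) ^ (-p.2.1) := by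
  classical
  rw [chainWeight_eq]
  by_cases ht : t ∈ simplex (N + 1)
  · rw [indicator_of_mem ht, if_pos (show (∀ k, 0 ≤ t k ∧ t k ≤ 1) ∧ Antitone t from ht)]
    have h0 : gap (L := N + 1) x t 0 ≠ 0 := by
      have := one_sub_ne_zero_of_norm_lt_one (norm_mul_ofReal_lt_one hx (pad_mem_Icc ht N))
      rw [gap, if_pos rfl, ← neg_ne_zero, neg_sub]
      exact this
    have h1 : ∏ k ∈ (Finset.range (N + 1)).erase 0, gap (L := N + 1) x t k =
        ∏ k ∈ Finset.range N, gap (L := N + 1) x t (k + 1) := by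
      apply mul_left_cancel₀ h0
      rw [Finset.mul_prod_erase _ _ (by simp), Finset.prod_range_succ', mul_comm]
    have h2 : phi (L := N + 1) x 0 t = (∏ k ∈ Finset.range N, gap (L := N + 1) x t (k + 1))⁻¹ := by
      rw [← h1]
      simp [phi]
    rw [h2, U, mul_right_comm]
    change (∏ k ∈ Finset.Icc 1 N, _) * _ * _ = _
    rw [prod_Icc_one, ← div_eq_mul_inv, ← Finset.prod_div_distrib]
    congr 1
    refine Finset.prod_congr rfl fun k _ => ?_
    rw [mul_div_assoc]
    rfl
  · rw [indicator_of_notMem ht,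
      if_neg (show ¬ ((∀ k, 0 ≤ t k ∧ t k ≤ 1) ∧ Antitone t) from ht), zero_mul]

theorem raise_mem_convergenceDomain (r : ℕ) {q : Params (N + 1)}
    (hq : q ∈ convergenceDomain (N + 1)) : raise r q ∈ convergenceDomain (N + 1) := by
  intro k
  have h := hq k
  simp only [raise]
  split_ifs with h1 h2 h2
  · simp only [Complex.add_re, Complex.one_re]
    exact ⟨by linarith, by linarith⟩
  · omega
  · simp only [Complex.add_re, Complex.one_re, Complex.zero_re]
    exact ⟨by linarith, by linarith⟩
  · simpa using h

/-- Trading `φ_0` for `φ_r` amounts to a contiguous shift of the parameters. The identity also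
holds on the faces of the simplex, where some gap vanishes: there `x / 0 = 0`, and `0 ^ c = 0`
because `γ_r - α_r` has positive real part. -/
theorem U_mul_phi_of_pos {q : Params (N + 1)} (hq : q ∈ convergenceDomain (N + 1)) {x : ℂ}
    (hx : ‖x‖ < 1) {t : Fin N → ℝ} (ht : t ∈ simplex (N + 1)) {r : ℕ} (hr0 : r ≠ 0)
    (hr : r < N + 1) :
    U q x t / ∏ k ∈ (Finset.range (N + 1)).erase r, gap (L := N + 1) x t k =
      -(U (raise r q) x t / ∏ k ∈ (Finset.range (N + 1)).erase 0, gap (L := N + 1) x t k) := by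
  have hrI : r ∈ Finset.Icc 1 N := Finset.mem_Icc.2 ⟨by omega, by omega⟩
  have hset0 : (Finset.range (N + 1)).erase 0 = Finset.Icc 1 N := by
    ext k; simp; omega
  have hsetr : (Finset.range (N + 1)).erase r = insert 0 ((Finset.Icc 1 N).erase r) := by
    ext k; simp; omega
  have hW := one_sub_ne_zero_of_norm_lt_one (norm_mul_ofReal_lt_one hx (pad_mem_Icc ht N))
  have hgap0 : gap (L := N + 1) x t 0 = -(1 - x * ((pad (L := N + 1) 1 t N : ℝ) : ℂ)) := by
    rw [gap, if_pos rfl, neg_sub]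
    rfl
  have hgapr : gap (L := N + 1) x t r =
      ((pad (L := N + 1) 1 t (r - 1) - pad (L := N + 1) 1 t r : ℝ) : ℂ) := by
    rw [gap, if_neg hr0]
  have hα (k : ℕ) (hk : k ∈ Finset.Icc 1 N) :
      alpha (raise r q) k = alpha q k + if k < r then 1 else 0 := by
    obtain ⟨k, rfl⟩ : ∃ l, k = l + 1 := ⟨k - 1, by have := Finset.mem_Icc.1 hk; omega⟩
    have hk' : k < N := by have := Finset.mem_Icc.1 hk; omega
    rw [alpha_add_one _ ⟨k, hk'⟩, alpha_add_one _ ⟨k, hk'⟩]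
    rfl
  have hγ (k : ℕ) (hk : k ∈ Finset.Icc 1 N) :
      gamma (raise r q) k = gamma q k + if k ≤ r then 1 else 0 := by
    obtain ⟨k, rfl⟩ : ∃ l, k = l + 1 := ⟨k - 1, by have := Finset.mem_Icc.1 hk; omega⟩
    have hk' : k < N := by have := Finset.mem_Icc.1 hk; omega
    rw [gamma_add_one _ ⟨k, hk'⟩, gamma_add_one _ ⟨k, hk'⟩]
    rfl
  have hαγ (k : ℕ) (hk : k ∈ Finset.Icc 1 N) :
      alpha (raise r q) k - gamma (raise r q) (k + 1) = alpha q k - gamma q (k + 1) := by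
    have hk' := Finset.mem_Icc.1 hk
    rw [hα k hk]
    rcases hk'.2.lt_or_eq with h | rfl
    · rw [hγ (k + 1) (Finset.mem_Icc.2 ⟨by omega, by omega⟩)]
      simp only [Nat.succ_le_iff]
      ring
    · rw [gamma_self, gamma_self, if_neg (by omega), add_zero]
  have hγα (k : ℕ) (hk : k ∈ (Finset.Icc 1 N).erase r) :
      gamma (raise r q) k - alpha (raise r q) k = gamma q k - alpha q k := by
    rw [hα k (Finset.mem_of_mem_erase hk), hγ k (Finset.mem_of_mem_erase hk)]
    have : k ≤ r ↔ k < r := ⟨fun h => lt_of_le_of_ne h (Finset.ne_of_mem_erase hk), le_of_lt⟩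
    simp only [this]
    ring
  have hγαr : gamma (raise r q) r - alpha (raise r q) r = gamma q r - alpha q r + 1 := by
    rw [hα r hrI, hγ r hrI, if_pos le_rfl, if_neg (lt_irrefl r)]
    ring
  set D : ℂ := ((pad (L := N + 1) 1 t (r - 1) - pad (L := N + 1) 1 t r : ℝ) : ℂ)
  have hre : 0 < (gamma q r - alpha q r).re := by
    obtain ⟨k, rfl⟩ : ∃ l, r = l + 1 := ⟨r - 1, by omega⟩
    have hk' : k < N := by omega
    rw [alpha_add_one _ ⟨k, hk'⟩, gamma_add_one _ ⟨k, hk'⟩, Complex.sub_re]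
    exact sub_pos.2 (hq ⟨k, hk'⟩).2
  have hD : D ^ (gamma q r - alpha q r + 1) = D ^ (gamma q r - alpha q r) * D := by
    by_cases h : D = 0
    · rw [h, mul_zero, Complex.zero_cpow]
      intro h0
      have := congrArg Complex.re h0
      simp only [Complex.add_re, Complex.one_re, Complex.zero_re] at this
      linarith
    · rw [Complex.cpow_add _ _ h, Complex.cpow_one]
  have hβ : (raise r q).2.1 = q.2.1 + 1 := rfl
  set G := ∏ k ∈ (Finset.Icc 1 N).erase r, gap (L := N + 1) x t k
  set A := ∏ k ∈ (Finset.Icc 1 N).erase r,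
    ((pad (L := N + 1) 1 t k : ℝ) : ℂ) ^ (alpha q k - gamma q (k + 1)) *
        ((pad (L := N + 1) 1 t (k - 1) - pad (L := N + 1) 1 t k : ℝ) : ℂ) ^ (gamma q k - alpha q k)
  set T := ((pad (L := N + 1) 1 t r : ℝ) : ℂ) ^ (alpha q r - gamma q (r + 1))
  set W := 1 - x * ((pad (L := N + 1) 1 t N : ℝ) : ℂ)
  have hU : U q x t = T * D ^ (gamma q r - alpha q r) * A * W ^ (-q.2.1) := by
    rw [U]
    congr 1
    exact (Finset.mul_prod_erase _ _ hrI).symm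
  have hU' : U (raise r q) x t =
      T * (D ^ (gamma q r - alpha q r) * D) * A * (W ^ (-q.2.1) / W) := by
    have hWβ : W ^ (-q.2.1) / W = W ^ (-q.2.1 - 1) := by
      rw [Complex.cpow_sub _ _ hW, Complex.cpow_one]
    rw [hWβ, U, hβ, neg_add']
    congr 1
    refine (Finset.mul_prod_erase (Finset.Icc 1 N) _ hrI).symm.trans ?_
    rw [hαγ r hrI, hγαr, hD]
    congr 1
    refine Finset.prod_congr rfl fun k hk => ?_
    rw [hαγ k (Finset.mem_of_mem_erase hk), hγα k hk]
  rw [hset0, hsetr, Finset.prod_insert (by simp), ← Finset.mul_prod_erase _ _ hrI, hgap0, hgapr,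
    hU, hU']
  by_cases h : D = 0
  · have hne : gamma q r - alpha q r ≠ 0 := by
      intro h0
      rw [h0] at hre
      exact lt_irrefl _ hre
    simp [h, Complex.zero_cpow hne]
  · by_cases hG : G = 0
    · simp [G, hG]
    · field_simp

/-- The value of `∫_{Δ_0} U φ_j` as a hypergeometric series; the formula makes sense on the whole
of `regularDomain`. -/
noncomputable def eulerValue (x : ℂ) (j : ℤ) (q : Params (N + 1)) : ℂ :=
  x ^ (-(j / ((N + 1 : ℕ) : ℤ))) * if (j % ((N + 1 : ℕ) : ℤ)).toNat = 0 then hyp q x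
    else -hyp (raise (j % ((N + 1 : ℕ) : ℤ)).toNat q) x

theorem U_mul_phi {q : Params (N + 1)} (hq : q ∈ convergenceDomain (N + 1)) {x : ℂ}
    (hx : ‖x‖ < 1) (j : ℤ) {t : Fin N → ℝ} (ht : t ∈ simplex (N + 1)) :
    U q x t * phi (L := N + 1) x j t = x ^ (-(j / ((N + 1 : ℕ) : ℤ))) *
      if (j % ((N + 1 : ℕ) : ℤ)).toNat = 0 then U q x t * phi (L := N + 1) x 0 t
      else -(U (raise (j % ((N + 1 : ℕ) : ℤ)).toNat q) x t * phi (L := N + 1) x 0 t) := by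
  have hphi : phi (L := N + 1) x 0 t =
      1 / ∏ k ∈ (Finset.range (N + 1)).erase 0, gap (L := N + 1) x t k := by
    simp [phi]
  have hlt : (j % ((N + 1 : ℕ) : ℤ)).toNat < N + 1 := by
    have := Int.emod_lt_of_pos j (show (0 : ℤ) < ((N + 1 : ℕ) : ℤ) by positivity)
    omega
  rw [hphi, phi]
  split_ifs with h
  · rw [h]
    ring
  · have := U_mul_phi_of_pos hq hx ht h hlt
    rw [mul_one_div, ← this]
    ring

theorem measurable_one_sub_cpow (x b : ℂ) : Measurable fun u : ℝ => (1 - x * (u : ℂ)) ^ (-b) := by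
  fun_prop

theorem exists_one_sub_cpow_bound {x : ℂ} (hx : ‖x‖ < 1) (b : ℂ) :
    ∃ M : NNReal, ∀ u ∈ Icc (0 : ℝ) 1, ‖(1 - x * (u : ℂ)) ^ (-b)‖ₑ ≤ M := by
  have hc : ContinuousOn (fun u : ℝ => (1 - x * (u : ℂ)) ^ (-b)) (Icc 0 1) := by
    refine ContinuousOn.cpow (by fun_prop) continuousOn_const fun u hu => ?_
    have := norm_mul_ofReal_lt_one hx hu
    left
    have h2 := (Complex.abs_re_le_norm (x * (u : ℂ))).trans_lt this
    rw [Complex.sub_re, Complex.one_re]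
    linarith [(abs_lt.1 h2).2]
  obtain ⟨M, hM⟩ := isCompact_Icc.exists_bound_of_continuousOn hc
  refine ⟨M.toNNReal, fun u hu => ?_⟩
  rw [← ofReal_norm]
  exact ENNReal.ofReal_le_ofReal (hM u hu)

theorem re_bounds_of_mem {q : Params (N + 1)} (hq : q ∈ convergenceDomain (N + 1)) :
    ∀ k < N, 0 < (alpha q (k + 1)).re ∧ (alpha q (k + 1)).re < (gamma q (k + 1)).re := by
  intro k hk
  rw [alpha_add_one q ⟨k, hk⟩, gamma_add_one q ⟨k, hk⟩]
  exact hq ⟨k, hk⟩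

theorem integrableOn_U_mul_phi_zero {q : Params (N + 1)} (hq : q ∈ convergenceDomain (N + 1))
    {x : ℂ} (hx : ‖x‖ < 1) : IntegrableOn (fun t => U q x t * phi x 0 t) (simplex (N + 1)) := by
  obtain ⟨M, hM⟩ := exists_one_sub_cpow_bound hx q.2.1
  rw [← integrable_indicator_iff measurableSet_simplex]
  exact (integrable_chainWeight (re_bounds_of_mem hq) (gamma_self q)
    (measurable_one_sub_cpow x q.2.1) hM (s := 1) (by simp)).congr
    (ae_of_all _ fun t => (indicator_U_mul_phi_zero q hx t).symm)

theorem integral_U_mul_phi_zero {q : Params (N + 1)} (hq : q ∈ convergenceDomain (N + 1))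
    {x : ℂ} (hx : ‖x‖ < 1) : ∫ t in simplex (N + 1), U q x t * phi x 0 t = hyp q x := by
  have hre := re_bounds_of_mem hq
  set w : (Fin N → ℝ) → ℂ :=
    chainWeight N (fun k => alpha q (k + 1)) (fun k => gamma q (k + 1)) 1
  have h1 : (1 : ℝ) ∈ Ioc (0 : ℝ) 1 := by simp
  have hint (i : ℕ) : Integrable fun t => w t * ((pad (L := N + 1) 1 t N : ℝ) : ℂ) ^ i :=
    integrable_chainWeight hre (gamma_self q) (g := fun u => (u : ℂ) ^ i) (by fun_prop)
      (enorm_pow_le_one i) h1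
  obtain ⟨C, hC⟩ := exists_lintegral_chainWeight_le hre (gamma_self q)
  have hCi (i : ℕ) : ∫ t, ‖w t * ((pad (L := N + 1) 1 t N : ℝ) : ℂ) ^ i‖ ≤ C := by
    have := hC (fun u => (u : ℂ) ^ i) 1 (by fun_prop) (enorm_pow_le_one i) 1 h1
    rw [integral_norm_eq_lintegral_enorm (hint i).aestronglyMeasurable]
    refine ENNReal.toReal_le_of_le_ofReal C.2 (this.trans (le_of_eq ?_))
    simp
  set F : ℕ → (Fin N → ℝ) → ℂ := fun i t =>
    binCoeff q.2.1 i * x ^ i * (w t * ((pad (L := N + 1) 1 t N : ℝ) : ℂ) ^ i)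
  have hF (i) : Integrable (F i) := (hint i).const_mul _
  have hFsum : Summable fun i => ∫ t, ‖F i t‖ := by
    refine ((summable_norm_binCoeff q.2.1 hx).mul_right (C : ℝ)).of_nonneg_of_le
      (fun i => integral_nonneg fun _ => norm_nonneg _) fun i => ?_
    simp only [F, norm_mul (binCoeff q.2.1 i * x ^ i)]
    rw [integral_const_mul]
    gcongr
    exact hCi i
  have hsum := hasSum_integral_of_summable_integral_norm hF hFsum
  have hterm (i) : ∫ t, F i t = hypTerm q i * x ^ i := by
    rw [integral_const_mul, integral_chainWeight_pow hre (gamma_self q) i h1, hypTerm,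
      Finset.prod_range]
    simp only [alpha_add_one, gamma_add_one]
    simp
    ring
  have hpt (t : Fin N → ℝ) : ∑' i, F i t =
      (simplex (N + 1)).indicator (fun t => U q x t * phi x 0 t) t := by
    rw [indicator_U_mul_phi_zero q hx]
    by_cases ht : t ∈ simplex (N + 1)
    · have := (hasSum_binCoeff q.2.1
        (norm_mul_ofReal_lt_one hx (pad_mem_Icc ht N))).mul_left (w t)
      refine (this.congr_fun fun i => ?_).tsum_eq
      simp only [F, mul_pow]
      ring
    · have : w t = 0 := by
        classical
        rw [show w t = _ from chainWeight_eq _ _ _ _,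
          if_neg (show ¬ ((∀ k, 0 ≤ t k ∧ t k ≤ 1) ∧ Antitone t) from ht)]
      simp [F, this, show chainWeight N (fun k => alpha q (k + 1)) (fun k => gamma q (k + 1)) 1 t
        = 0 from this]
  simp only [hterm, hpt] at hsum
  rw [← integral_indicator measurableSet_simplex]
  exact hsum.tsum_eq.symm

theorem integrableOn_U_mul_phi {q : Params (N + 1)} (hq : q ∈ convergenceDomain (N + 1))
    {x : ℂ} (hx : ‖x‖ < 1) (j : ℤ) :
    IntegrableOn (fun t => U q x t * phi x j t) (simplex (N + 1)) := by
  refine IntegrableOn.congr_fun ?_ (fun t ht => (U_mul_phi hq hx j ht).symm)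
    measurableSet_simplex
  refine Integrable.const_mul ?_ _
  split_ifs
  · exact integrableOn_U_mul_phi_zero hq hx
  · exact (integrableOn_U_mul_phi_zero (raise_mem_convergenceDomain _ hq) hx).neg

theorem integral_U_mul_phi {q : Params (N + 1)} (hq : q ∈ convergenceDomain (N + 1))
    {x : ℂ} (hx : ‖x‖ < 1) (j : ℤ) :
    ∫ t in simplex (N + 1), U q x t * phi x j t = eulerValue x j q := by
  rw [setIntegral_congr_fun measurableSet_simplex fun t ht => U_mul_phi hq hx j ht,
    integral_const_mul, eulerValue]
  split_ifs
  · rw [integral_U_mul_phi_zero hq hx]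
  · rw [integral_neg, integral_U_mul_phi_zero (raise_mem_convergenceDomain _ hq) hx]

/-! ### Holomorphic continuation in the parameters -/

theorem differentiable_raise (r : ℕ) : Differentiable ℂ (raise (L := N + 1) r) := by
  unfold raise
  refine .prodMk ?_ (.prodMk (by fun_prop) ?_)
  · exact differentiable_pi.2 fun k => by fun_prop
  · exact differentiable_pi.2 fun k => by fun_prop

theorem isContinuation_eulerValue {x : ℂ} (hx : ‖x‖ < 1) (j : ℤ) :
    IsContinuation (L := N + 1) x j (eulerValue x j) := by
  refine ⟨?_, fun q hq => (integral_U_mul_phi hq hx j).symm⟩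
  unfold eulerValue
  refine DifferentiableOn.const_mul ?_ _
  split_ifs
  · exact differentiableOn_hyp_param hx
  · exact ((differentiableOn_hyp_param hx).comp (differentiable_raise _).differentiableOn
      fun q hq => raise_mem_regularDomain _ hq).neg

theorem convergenceDomain_subset : convergenceDomain (N + 1) ⊆ regularDomain (N + 1) := by
  intro q hq k n
  have h := hq k
  have hn : (0 : ℝ) ≤ n := n.cast_nonneg
  constructor <;> intro h0
  · rw [h0] at h
    simp only [Complex.neg_re, Complex.natCast_re] at h
    linarith [h.1]
  · have := congrArg Complex.re h0
    simp only [Complex.neg_re, Complex.natCast_re, Complex.sub_re] at this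
    linarith [h.2]

theorem isOpen_convergenceDomain : IsOpen (convergenceDomain (N + 1)) := by
  rw [convergenceDomain, ofPred_forall]
  refine isOpen_iInter_of_finite fun k => IsOpen.inter ?_ ?_
  · exact isOpen_lt (f := fun _ => (0 : ℝ)) (g := fun q : Params (N + 1) => (q.1 k).re)
      (by fun_prop) (by fun_prop)
  · exact isOpen_lt (f := fun q : Params (N + 1) => (q.1 k).re)
      (g := fun q : Params (N + 1) => (q.2.2 k).re) (by fun_prop) (by fun_prop)

theorem countable_affine_eq (a : ℂ) (n : ℕ) : {z : ℂ | 1 + z * (a - 1) = -(n : ℂ)}.Countable := by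
  apply Set.Subsingleton.countable
  intro z hz w hw
  simp only [mem_ofPred_eq] at hz hw
  have h : (z - w) * (a - 1) = 0 := by linear_combination hz - hw
  rcases mul_eq_zero.1 h with h | h
  · exact sub_eq_zero.1 h
  · rw [h, mul_zero, add_zero] at hz
    have := congrArg Complex.re hz
    simp only [Complex.one_re, Complex.neg_re, Complex.natCast_re] at this
    linarith [(n.cast_nonneg : (0 : ℝ) ≤ n)]

/-- Uniqueness of continuation. A complex line through a point of the convergence domain meets the
complement of the regular domain in a countable set, so the identity theorem in one variable
applies on it. -/
theorem eqOn_regularDomain {F G : Params (N + 1) → ℂ}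
    (hF : DifferentiableOn ℂ F (regularDomain (N + 1)))
    (hG : DifferentiableOn ℂ G (regularDomain (N + 1)))
    (h : EqOn F G (convergenceDomain (N + 1))) : EqOn F G (regularDomain (N + 1)) := by
  intro p hp
  set p₀ : Params (N + 1) := (fun _ => 1, 0, fun _ => 2)
  have hp₀ : p₀ ∈ convergenceDomain (N + 1) := by
    intro k
    simp [p₀]
  set ℓ : ℂ → Params (N + 1) := fun z => p₀ + z • (p - p₀)
  have hℓ : Differentiable ℂ ℓ := by fun_prop
  have hℓ0 : ℓ 0 = p₀ := by simp [ℓ]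
  have hℓ1 : ℓ 1 = p := by simp [ℓ]
  set S : Set ℂ := ℓ ⁻¹' regularDomain (N + 1)
  have hSo : IsOpen S := isOpen_regularDomain.preimage hℓ.continuous
  have hSc : Sᶜ.Countable := by
    have : Sᶜ ⊆ ⋃ k : Fin N, ⋃ n : ℕ, ({z : ℂ | 1 + z * (p.1 k - 1) = -(n : ℂ)} ∪
        {z : ℂ | 1 + z * ((p.2.2 k - p.1 k) - 1) = -(n : ℂ)}) := by
      intro z hz
      simp only [S, mem_compl_iff, mem_preimage, regularDomain, mem_ofPred_eq, not_forall,
        not_and_or, not_ne_iff] at hz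
      obtain ⟨k, n, hk⟩ := hz
      refine mem_iUnion₂.2 ⟨k, n, hk.imp (fun h => ?_) fun h => ?_⟩
      · rw [mem_ofPred_eq, ← h]
        simp [ℓ, p₀]
      · rw [mem_ofPred_eq, ← h]
        simp only [ℓ, p₀, Prod.fst_add, Prod.snd_add, Prod.smul_fst, Prod.smul_snd, Prod.fst_sub,
          Prod.snd_sub, Pi.add_apply, Pi.smul_apply, Pi.sub_apply, smul_eq_mul]
        ring
    refine Set.Countable.mono this (countable_iUnion fun k => countable_iUnion fun n => ?_)
    exact (countable_affine_eq _ n).union (countable_affine_eq _ n)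
  have hSconn : IsPreconnected S := by
    have := (hSc.isConnected_compl_of_one_lt_rank (by simp)).isPreconnected
    rwa [compl_compl] at this
  have h0S : (0 : ℂ) ∈ S := by
    change ℓ 0 ∈ regularDomain (N + 1)
    rw [hℓ0]
    exact convergenceDomain_subset hp₀
  have h1S : (1 : ℂ) ∈ S := by
    change ℓ 1 ∈ regularDomain (N + 1)
    rwa [hℓ1]
  have hFan : AnalyticOnNhd ℂ (F ∘ ℓ) S :=
    (hF.comp hℓ.differentiableOn fun z hz => hz).analyticOnNhd hSo
  have hGan : AnalyticOnNhd ℂ (G ∘ ℓ) S :=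
    (hG.comp hℓ.differentiableOn fun z hz => hz).analyticOnNhd hSo
  have hev : F ∘ ℓ =ᶠ[𝓝 0] G ∘ ℓ := by
    have : ℓ ⁻¹' convergenceDomain (N + 1) ∈ 𝓝 (0 : ℂ) :=
      hℓ.continuous.continuousAt.preimage_mem_nhds
        (isOpen_convergenceDomain.mem_nhds (by rwa [hℓ0]))
    filter_upwards [this] with z hz using h hz
  have := hFan.eqOn_of_preconnected_of_eventuallyEq hGan hSconn h0S hev h1S
  simpa [hℓ1] using this

theorem isContinuation_eulerIntegral {x : ℂ} (hx : ‖x‖ < 1) (j : ℤ) :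
    IsContinuation (L := N + 1) x j (eulerIntegral x j) := by
  have h : ∃ F : Params (N + 1) → ℂ, IsContinuation x j F :=
    ⟨_, isContinuation_eulerValue hx j⟩
  have heq : eulerIntegral (L := N + 1) x j = h.choose := by
    funext p
    rw [eulerIntegral, dif_pos h]
  rw [heq]
  exact h.choose_spec

theorem eulerIntegral_eq {x : ℂ} (hx : ‖x‖ < 1) (j : ℤ) {q : Params (N + 1)}
    (hq : q ∈ regularDomain (N + 1)) : eulerIntegral x j q = eulerValue x j q := by
  have h1 := isContinuation_eulerIntegral (N := N) hx j
  have h2 := isContinuation_eulerValue (N := N) hx j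
  exact eqOn_regularDomain h1.1 h2.1 (fun p hp => (h1.2 p hp).trans (h2.2 p hp).symm) hq

end

/-! ### Linear systems and determinants -/

section Linear

variable {L : ℕ}

/-- Jacobi's formula for the derivative of a determinant. -/
theorem hasDerivAt_det {M : ℂ → Matrix (Fin L) (Fin L) ℂ} {M' : Matrix (Fin L) (Fin L) ℂ} {x : ℂ}
    (hM : ∀ i j, HasDerivAt (fun x => M x i j) (M' i j) x) :
    HasDerivAt (fun x => (M x).det) (M' * (M x).adjugate).trace x := by
  let D : ContinuousMultilinearMap ℂ (fun _ : Fin L => Fin L → ℂ) ℂ :=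
    { toMultilinearMap := (Matrix.detRowAlternating (R := ℂ) (n := Fin L)).toMultilinearMap
      cont := Continuous.matrix_det continuous_id }
  have hrow (i : Fin L) : HasFDerivAt (fun x => M x i)
      (ContinuousLinearMap.toSpanSingleton ℂ (M' i)) x :=
    (hasDerivAt_pi.2 (hM i)).hasFDerivAt
  have h : HasDerivAt (fun x => (M x).det) _ x :=
    (HasFDerivAt.multilinear_comp (f := D) hrow).hasDerivAt
  convert h using 1
  rw [sum_apply, Matrix.trace]
  refine Finset.sum_congr rfl fun i _ => ?_
  have hD : (D.toContinuousLinearMap (fun j => M x j) i ∘L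
      ContinuousLinearMap.toSpanSingleton ℂ (M' i)) 1 = ((M x).updateRow i (M' i)).det := by
    simp only [ContinuousLinearMap.comp_apply, ContinuousLinearMap.toSpanSingleton_apply, one_smul]
    rfl
  rw [hD, Matrix.det_eq_sum_mul_adjugate_row _ i, Matrix.diag_apply, Matrix.mul_apply]
  refine Finset.sum_congr rfl fun j _ => ?_
  rw [Matrix.adjugate_apply, Matrix.adjugate_apply, Matrix.updateRow_idem,
    Matrix.updateRow_self]

theorem differentiableAt_inv_apply {M : ℂ → Matrix (Fin L) (Fin L) ℂ} {x : ℂ}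
    (hM : ∀ i j, DifferentiableAt ℂ (fun x => M x i j) x) (hdet : (M x).det ≠ 0) (i j : Fin L) :
    DifferentiableAt ℂ (fun x => (M x)⁻¹ i j) x := by
  have hd : DifferentiableAt ℂ (fun x => (M x).det) x :=
    (hasDerivAt_det (M' := Matrix.of fun i j => deriv (fun x => M x i j) x)
      fun i j => (hM i j).hasDerivAt).differentiableAt
  have hadj : DifferentiableAt ℂ (fun x => (M x).adjugate i j) x := by
    simp only [Matrix.adjugate_apply]
    have hrow (k l) : DifferentiableAt ℂ
        (fun x => (M x).updateRow j (Pi.single i 1) k l) x := by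
      by_cases hk : k = j
      · subst hk
        simp
      · simp only [Matrix.updateRow_ne hk]
        exact hM k l
    exact (hasDerivAt_det
      (M' := Matrix.of fun k l => deriv (fun x => (M x).updateRow j (Pi.single i 1) k l) x)
      fun k l => (hrow k l).hasDerivAt).differentiableAt
  simp only [Matrix.inv_def, Ring.inverse_eq_inv', Matrix.smul_apply, smul_eq_mul]
  exact (hd.inv hdet).mul hadj

/-- A matrix solution with non-vanishing determinant is a fundamental system: the vector `M⁻¹ y` of
a solution `y` has derivative zero. -/
theorem isFundamentalSystem_of_det_ne_zero {A M : ℂ → Matrix (Fin L) (Fin L) ℂ} {V : Set ℂ}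
    (hV : IsOpen V) (hVc : IsConnected V) (hM : ∀ n, IsSolution A V fun x m => M x m n)
    (hdet : ∀ x ∈ V, (M x).det ≠ 0) : IsFundamentalSystem A M V := by
  refine ⟨hM, fun y hy => ?_⟩
  have hMd (x) (hx : x ∈ V) (i j) : HasDerivAt (fun x => M x i j) ((A x * M x) i j) x :=
    hasDerivAt_pi.1 (hM j x hx) i
  set z : ℂ → Fin L → ℂ := fun x => (M x)⁻¹.mulVec (y x)
  have hyz (x) (hx : x ∈ V) : y x = (M x).mulVec (z x) := by
    rw [Matrix.mulVec_mulVec, Matrix.mul_nonsing_inv _ (isUnit_iff_ne_zero.2 (hdet x hx)),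
      Matrix.one_mulVec]
  have hzd (x) (hx : x ∈ V) : DifferentiableAt ℂ z x := by
    refine differentiableAt_pi.2 fun i => ?_
    simp only [z, Matrix.mulVec, dotProduct]
    refine DifferentiableAt.fun_sum fun j _ => ?_
    exact (differentiableAt_inv_apply (fun i j => (hMd x hx i j).differentiableAt) (hdet x hx)
      i j).mul (hasDerivAt_pi.1 (hy x hx) j).differentiableAt
  have hz' : V.EqOn (deriv z) 0 := by
    intro x hx
    have h1 : HasDerivAt y ((A x * M x).mulVec (z x) + (M x).mulVec (deriv z x)) x := by
      have : HasDerivAt (fun x => (M x).mulVec (z x))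
          ((A x * M x).mulVec (z x) + (M x).mulVec (deriv z x)) x := by
        refine hasDerivAt_pi.2 fun i => ?_
        simp only [Matrix.mulVec, dotProduct, Pi.add_apply, ← Finset.sum_add_distrib]
        exact HasDerivAt.fun_sum fun j _ =>
          (hMd x hx i j).mul (hasDerivAt_pi.1 (hzd x hx).hasDerivAt j)
      refine this.congr_of_eventuallyEq ?_
      filter_upwards [hV.mem_nhds hx] with w hw using hyz w hw
    have h2 := h1.unique (hy x hx)
    rw [← Matrix.mulVec_mulVec, ← hyz x hx, add_eq_left] at h2
    apply Matrix.mulVec_injective_of_det_ne_zero (hdet x hx)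
    rw [h2, Pi.zero_apply, Matrix.mulVec_zero]
  obtain ⟨c, hc⟩ := hV.exists_is_const_of_deriv_eq_zero hVc.isPreconnected
    (fun x hx => (hzd x hx).differentiableWithinAt) hz'
  refine ⟨c, fun x hx => by rw [hyz x hx, hc x hx], fun c' hc' => ?_⟩
  obtain ⟨x, hx⟩ := hVc.nonempty
  apply Matrix.mulVec_injective_of_det_ne_zero (hdet x hx)
  rw [← hc' x hx, hyz x hx, hc x hx]

end Linear

/-! ### The columns of `Φ` -/

section Columns

variable {N : ℕ}

theorem shift_mem_regularDomain {p : Params (N + 1)} (hp : NonResonant p) {n : ℕ}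
    (hn : n < N + 1) : shift n p ∈ regularDomain (N + 1) := by
  intro k M
  have hk : (k : ℕ) < N := k.2
  have h := hp n (k + 1 + n) hn (by omega) (by omega) M
  refine ⟨h.1, ?_⟩
  simpa [shift] using h.2.1

/-- The solution `R_m` of the difference equation `R_{m+1} - R_m = Φ_{m n}`, `0 ≤ m ≤ L - 1`, for
the `n`-th column of `Φ`, where `L = N + 1`, normalized by `R_0 = x R_L`. In terms of it
`R_m = ∑_{k < m} Φ_{k n} + x / (1 - x) ∑_k Φ_{k n}`, which is what row `m` of the system
multiplies by `α_m - γ_m`. -/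
noncomputable def ladder (p : Params (N + 1)) (n m : ℕ) (x : ℂ) : ℂ :=
  if m ≤ n then x * hyp (low (m + (N + 1) - n) (shift n p)) x else hyp (low (m - n) (shift n p)) x

theorem differentiableAt_ladder {p : Params (N + 1)} (hp : NonResonant p) {n : ℕ}
    (hn : n < N + 1) (m : ℕ) {x : ℂ} (hx : ‖x‖ < 1) : DifferentiableAt ℂ (ladder p n m) x := by
  have h (j) := differentiableAt_hyp
    (low_mem_regularDomain j (shift_mem_regularDomain hp hn)) hx
  unfold ladder
  split_ifs
  · exact differentiableAt_id.mul (h _)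
  · exact h _

theorem ladder_zero (p : Params (N + 1)) {n : ℕ} (hn : n < N + 1) (x : ℂ) :
    ladder p n 0 x = x * ladder p n (N + 1) x := by
  rw [ladder, ladder, if_pos (Nat.zero_le n), if_neg (by omega), zero_add]

theorem alpha_add_self (p : Params (N + 1)) (k : ℕ) : alpha p (k + (N + 1)) = alpha p k + 1 := by
  simp only [alpha, Nat.add_mod_right, Nat.add_div_right k (Nat.succ_pos N)]
  push_cast
  ring

theorem gamma_add_self (p : Params (N + 1)) (k : ℕ) : gamma p (k + (N + 1)) = gamma p k + 1 := by
  simp only [gamma, Nat.add_mod_right, Nat.add_div_right k (Nat.succ_pos N)]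
  push_cast
  ring

theorem eulerValue_of_lt {x : ℂ} {r : ℕ} (hr : r < N + 1) (hr0 : r ≠ 0) (e : ℕ)
    (q : Params (N + 1)) :
    eulerValue x ((r : ℤ) - (e : ℤ) * ((N + 1 : ℕ) : ℤ)) q = x ^ e * -hyp (raise r q) x := by
  have h1 : ((r : ℤ) - (e : ℤ) * ((N + 1 : ℕ) : ℤ)) % ((N + 1 : ℕ) : ℤ) = r := by
    rw [Int.sub_mul_emod_self_right]
    exact Int.emod_eq_of_lt (by positivity) (by exact_mod_cast hr)
  have h2 : ((r : ℤ) - (e : ℤ) * ((N + 1 : ℕ) : ℤ)) / ((N + 1 : ℕ) : ℤ) = -e := by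
    rw [sub_eq_add_neg, ← neg_mul, Int.add_mul_ediv_right _ _ (by positivity),
      Int.ediv_eq_zero_of_lt (by positivity) (by exact_mod_cast hr), zero_add]
  rw [eulerValue, h1, h2, Int.toNat_natCast, if_neg hr0, neg_neg, zpow_natCast]

theorem Phi_eq_sub {p : Params (N + 1)} (hp : NonResonant p) {x : ℂ} (hx : ‖x‖ < 1)
    (m n : Fin (N + 1)) : Phi p x m n = ladder p n (m + 1) x - ladder p n m x := by
  have hq := shift_mem_regularDomain hp n.2
  have hm := m.2
  have hn := n.2
  rw [Phi, Matrix.of_apply, eulerIntegral_eq hx _ hq]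
  rcases lt_trichotomy (m : ℕ) n with h | h | h
  · obtain ⟨k, hk⟩ : ∃ k : Fin N, (m : ℕ) + (N + 1) - n = k + 1 :=
      ⟨⟨m + N - n, by omega⟩, by simp only; omega⟩
    have hj : ((m : ℕ) : ℤ) - ((n : ℕ) : ℤ) =
        ((m + (N + 1) - n : ℕ) : ℤ) - ((1 : ℕ) : ℤ) * ((N + 1 : ℕ) : ℤ) := by
      push_cast [show (n : ℕ) ≤ m + (N + 1) by omega]
      ring
    rw [hj, eulerValue_of_lt (by omega) (by omega), ladder, ladder, if_pos (by omega),
      if_pos h.le, show (m : ℕ) + 1 + (N + 1) - n = m + (N + 1) - n + 1 by omega, hk,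
      neg_hyp_raise hq k hx]
    ring
  · rw [h, sub_self, ladder, ladder, if_neg (by omega), if_pos le_rfl, Nat.add_sub_cancel_left,
      Nat.add_sub_cancel_left, ← hyp_eq_sub hq hx]
    simp [eulerValue]
  · obtain ⟨k, hk⟩ : ∃ k : Fin N, (m : ℕ) - n = k + 1 :=
      ⟨⟨m - n - 1, by omega⟩, by simp only; omega⟩
    have hj : ((m : ℕ) : ℤ) - ((n : ℕ) : ℤ) =
        ((m - n : ℕ) : ℤ) - ((0 : ℕ) : ℤ) * ((N + 1 : ℕ) : ℤ) := by
      push_cast [h.le]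
      ring
    rw [hj, eulerValue_of_lt (by omega) (by omega), ladder, ladder, if_neg (by omega),
      if_neg (by omega), show (m : ℕ) + 1 - n = m - n + 1 by omega, hk,
      neg_hyp_raise hq k hx, pow_zero, one_mul]

/-- The first-order recursion `(θ + γ_m - γ_n) R_{m+1} = (θ + α_m - γ_n) R_m` with
`θ = x d/dx`. -/
theorem ladder_succ {p : Params (N + 1)} (hp : NonResonant p) {n m : ℕ} (hn : n < N + 1)
    (hm : m < N + 1) {x : ℂ} (hx : ‖x‖ < 1) :
    x * deriv (ladder p n (m + 1)) x + (gamma p m - gamma p n) * ladder p n (m + 1) x =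
      x * deriv (ladder p n m) x + (alpha p m - gamma p n) * ladder p n m x := by
  have hq := shift_mem_regularDomain hp hn
  have hlow (j) : HasDerivAt (hyp (low j (shift n p))) (deriv (hyp (low j (shift n p))) x) x :=
    (differentiableAt_hyp (low_mem_regularDomain j hq) hx).hasDerivAt
  have hd (j) : deriv (fun x => x * hyp (low j (shift n p)) x) x =
      hyp (low j (shift n p)) x + x * deriv (hyp (low j (shift n p))) x := by
    simpa using ((hasDerivAt_id x).fun_mul (hlow j)).deriv
  rcases lt_trichotomy m n with h | h | h
  · obtain ⟨k, hk⟩ : ∃ k : Fin N, m + (N + 1) - n = k + 1 :=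
      ⟨⟨m + N - n, by omega⟩, by simp only; omega⟩
    have h1 : ladder p n (m + 1) = fun x => x * hyp (low (k + 1 + 1) (shift n p)) x := by
      funext x
      rw [ladder, if_pos (by omega), ← hk]
      congr 3
      omega
    have h2 : ladder p n m = fun x => x * hyp (low (k + 1) (shift n p)) x := by
      funext x
      rw [ladder, if_pos h.le, hk]
    have h3 := hyp_low_succ hq k hx
    have hα : (shift n p).1 k = alpha p m + 1 - gamma p n := by
      rw [← alpha_add_self, ← show (k : ℕ) + 1 + n = m + (N + 1) by omega]
      rfl
    have hγ : (shift n p).2.2 k = gamma p m + 1 - gamma p n := by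
      rw [← gamma_add_self, ← show (k : ℕ) + 1 + n = m + (N + 1) by omega]
      rfl
    rw [hα, hγ] at h3
    rw [h1, h2, hd, hd]
    linear_combination x * h3
  · subst h
    have h1 : ladder p m (m + 1) = hyp (low 1 (shift m p)) := by
      funext x
      rw [ladder, if_neg (by omega), Nat.add_sub_cancel_left]
    have h2 : ladder p m m = fun x => x * hyp (low (N + 1) (shift m p)) x := by
      funext x
      rw [ladder, if_pos le_rfl, Nat.add_sub_cancel_left]
    have hβ : (shift m p).2.1 = alpha p m - gamma p m := rfl
    have h3 := hyp_low_one hq hx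
    rw [hβ] at h3
    rw [h1, h2, hd]
    linear_combination h3
  · obtain ⟨k, hk⟩ : ∃ k : Fin N, m - n = k + 1 :=
      ⟨⟨m - n - 1, by omega⟩, by simp only; omega⟩
    have h1 : ladder p n (m + 1) = hyp (low (k + 1 + 1) (shift n p)) := by
      funext x
      rw [ladder, if_neg (by omega), ← hk]
      congr 2
      omega
    have h2 : ladder p n m = hyp (low (k + 1) (shift n p)) := by
      funext x
      rw [ladder, if_neg (by omega), hk]
    have h3 := hyp_low_succ hq k hx
    have hα : (shift n p).1 k = alpha p m - gamma p n := by
      rw [← show (k : ℕ) + 1 + n = m by omega]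
      rfl
    have hγ : (shift n p).2.2 k = gamma p m - gamma p n := by
      rw [← show (k : ℕ) + 1 + n = m by omega]
      rfl
    rw [hα, hγ] at h3
    rw [h1, h2]
    exact h3

theorem hasDerivAt_Phi_sub {p : Params (N + 1)} (hp : NonResonant p) {x : ℂ} (hx : ‖x‖ < 1)
    (m n : Fin (N + 1)) : HasDerivAt (fun x => Phi p x m n)
      (deriv (ladder p n (m + 1)) x - deriv (ladder p n m) x) x := by
  refine ((differentiableAt_ladder hp n.2 _ hx).hasDerivAt.sub
    (differentiableAt_ladder hp n.2 _ hx).hasDerivAt).congr_of_eventuallyEq ?_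
  filter_upwards [Metric.isOpen_ball.mem_nhds (mem_ball_zero_iff.2 hx)] with w hw
  exact Phi_eq_sub hp (mem_ball_zero_iff.1 hw) m n

theorem coeff_mul_Phi {p : Params (N + 1)} (hp : NonResonant p) {x : ℂ} (hx : ‖x‖ < 1)
    (hx0 : x ≠ 0) (m n : Fin (N + 1)) : x * (coeff p x * Phi p x) m n =
      (alpha p m - gamma p m) * ladder p n m x - gamma p m * Phi p x m n := by
  have hx1 : 1 - x ≠ 0 := one_sub_ne_zero_of_norm_lt_one hx
  set a := alpha p m - gamma p m
  have htot : ∑ k, Phi p x k n = ladder p n (N + 1) x - ladder p n 0 x := by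
    rw [← Finset.sum_range_sub (fun k => ladder p n k x), Finset.sum_range]
    exact Finset.sum_congr rfl fun k _ => Phi_eq_sub hp hx k n
  have hpart : ∑ k, (if k < m then Phi p x k n else 0) = ladder p n m x - ladder p n 0 x := by
    rw [← Finset.sum_range_sub (fun k => ladder p n k x)]
    have : Finset.range m = (Finset.range (N + 1)).filter (· < (m : ℕ)) := by
      ext k
      have := m.2
      simp
      omega
    rw [this, Finset.sum_filter, Finset.sum_range]
    refine Finset.sum_congr rfl fun k _ => ?_
    rw [Phi_eq_sub hp hx k n]
    rfl
  have hsum : (coeff p x * Phi p x) m n =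
      1 / x * (a * ∑ k, (if k < m then Phi p x k n else 0) - gamma p m * Phi p x m n) +
        1 / (1 - x) * a * ∑ k, Phi p x k n := by
    have hdiag : gamma p m * Phi p x m n =
        ∑ k, if k = m then gamma p m * Phi p x k n else 0 := by simp
    rw [Matrix.mul_apply, hdiag, Finset.mul_sum, ← Finset.sum_sub_distrib, Finset.mul_sum,
      Finset.mul_sum, ← Finset.sum_add_distrib]
    refine Finset.sum_congr rfl fun k _ => ?_
    rw [coeff, Matrix.of_apply]
    rcases lt_trichotomy k m with h | h | h
    · rw [if_pos h, if_pos h, if_neg h.ne]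
      ring
    · rw [if_neg h.not_lt, if_pos h, if_neg h.not_lt, if_pos h]
      ring
    · rw [if_neg h.not_gt, if_neg h.ne', if_neg h.not_gt, if_neg h.ne']
      ring
  have h0 := ladder_zero p n.2 x
  rw [hsum, hpart, htot, h0]
  field_simp
  ring

/-- The equation satisfied by the `n`-th column of `Φ`: the one for `Φ x^{-γ_n}`, with the factor
`x^{-γ_n}` removed. -/
theorem hasDerivAt_Phi {p : Params (N + 1)} (hp : NonResonant p) {x : ℂ} (hx : ‖x‖ < 1)
    (hx0 : x ≠ 0) (m n : Fin (N + 1)) : HasDerivAt (fun x => Phi p x m n)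
      ((coeff p x * Phi p x) m n + gamma p n / x * Phi p x m n) x := by
  convert hasDerivAt_Phi_sub hp hx m n using 1
  have h1 := coeff_mul_Phi hp hx hx0 m n
  have h2 := ladder_succ hp n.2 m.2 hx
  have h3 := Phi_eq_sub hp hx m n
  apply mul_left_cancel₀ hx0
  rw [mul_add, h1, h3]
  field_simp
  linear_combination -h2

theorem analyticOnNhd_Phi {p : Params (N + 1)} (hp : NonResonant p) (m n : Fin (N + 1)) :
    AnalyticOnNhd ℂ (fun x => Phi p x m n) (Metric.ball 0 1) := by
  refine DifferentiableOn.analyticOnNhd (fun x hx => ?_) Metric.isOpen_ball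
  exact (hasDerivAt_Phi_sub hp (mem_ball_zero_iff.1 hx) m n).differentiableAt
    |>.differentiableWithinAt

theorem Phi_zero_of_lt {p : Params (N + 1)} (hp : NonResonant p) {m n : Fin (N + 1)}
    (h : m < n) : Phi p 0 m n = 0 := by
  have h' : (m : ℕ) < n := h
  rw [Phi_eq_sub hp (by simp), ladder, ladder, if_pos (by omega), if_pos h'.le]
  simp

theorem betaFactor_zero_ne_zero {a c : ℂ} (ha : ∀ N : ℕ, a ≠ -(N : ℂ))
    (hc : ∀ N : ℕ, c ≠ -(N : ℂ)) (hca : ∀ N : ℕ, c - a ≠ -(N : ℂ)) : betaFactor a c 0 ≠ 0 := by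
  rw [betaFactor, Nat.cast_zero, add_zero, add_zero]
  exact mul_ne_zero (mul_ne_zero (Complex.Gamma_ne_zero hca) (Complex.Gamma_ne_zero ha))
    (inv_ne_zero (Complex.Gamma_ne_zero hc))

theorem Phi_zero_diag_ne_zero {p : Params (N + 1)} (hp : NonResonant p) (n : Fin (N + 1)) :
    Phi p 0 n n ≠ 0 := by
  have hq := shift_mem_regularDomain hp n.2
  rw [Phi, Matrix.of_apply, eulerIntegral_eq (by simp) _ hq, sub_self]
  simp only [eulerValue, Int.zero_ediv, neg_zero, zpow_zero, one_mul, Int.zero_emod,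
    Int.toNat_zero, if_true, hyp_zero, hypTerm]
  refine mul_ne_zero (by simp [binCoeff]) (Finset.prod_ne_zero_iff.2 fun k _ => ?_)
  refine betaFactor_zero_ne_zero (fun M => (hq k M).1) (fun M => ?_) fun M => (hq k M).2
  have hk : (k : ℕ) < N := k.2
  exact (hp n (k + 1 + n) n.2 (by omega) (by omega) M).2.2

theorem det_Phi_zero_ne_zero {p : Params (N + 1)} (hp : NonResonant p) :
    (Phi p 0).det ≠ 0 := by
  rw [Matrix.det_of_isLowerTriangular (Phi p 0) fun m n h => Phi_zero_of_lt hp h]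
  exact Finset.prod_ne_zero_iff.2 fun n _ => Phi_zero_diag_ne_zero hp n

/-- Liouville's formula: the poles at `0` cancel in the equation of `det Φ`. -/
theorem hasDerivAt_det_Phi {p : Params (N + 1)} (hp : NonResonant p) {x : ℂ} (hx : ‖x‖ < 1)
    (hx0 : x ≠ 0) : HasDerivAt (fun x => (Phi p x).det)
      ((∑ m : Fin (N + 1), (alpha p m - gamma p m)) / (1 - x) * (Phi p x).det) x := by
  have h := hasDerivAt_det (M := Phi p)
    (M' := coeff p x * Phi p x + Phi p x * Matrix.diagonal fun n : Fin (N + 1) => gamma p n / x)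
    fun m n => by
      convert hasDerivAt_Phi hp hx hx0 m n using 1
      rw [Matrix.add_apply, Matrix.mul_diagonal]
      ring
  convert h using 1
  rw [add_mul, Matrix.trace_add, mul_assoc, Matrix.mul_adjugate, Matrix.trace_mul_cycle,
    Matrix.adjugate_mul, mul_smul_comm, mul_one, smul_mul_assoc, one_mul, Matrix.trace_smul,
    Matrix.trace_smul, Matrix.trace_diagonal, Matrix.trace, smul_eq_mul, smul_eq_mul, ← mul_add,
    ← Finset.sum_add_distrib, mul_comm, Finset.sum_div]
  congr 1
  refine Finset.sum_congr rfl fun m _ => ?_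
  simp only [Matrix.diag_apply, coeff, Matrix.of_apply, lt_irrefl, if_false, if_true]
  ring

theorem det_Phi_ne_zero {p : Params (N + 1)} (hp : NonResonant p) {x : ℂ} (hx : ‖x‖ < 1) :
    (Phi p x).det ≠ 0 := by
  set a : ℂ := ∑ m : Fin (N + 1), (alpha p m - gamma p m)
  -- `det Φ` is a constant multiple of `(1 - x)^{-a}`.
  set g : ℂ → ℂ := fun x => (Phi p x).det * (1 - x) ^ a
  have hslit {x : ℂ} (hx : ‖x‖ < 1) : 1 - x ∈ Complex.slitPlane := by
    left
    rw [Complex.sub_re, Complex.one_re]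
    linarith [(abs_lt.1 ((Complex.abs_re_le_norm x).trans_lt hx)).2]
  have hpow {x : ℂ} (hx : ‖x‖ < 1) :
      HasDerivAt (fun x => (1 - x) ^ a) (a * (1 - x) ^ (a - 1) * -1) x :=
    ((hasDerivAt_id x).const_sub 1).cpow_const (hslit hx)
  have hdet {x : ℂ} (hx : ‖x‖ < 1) : DifferentiableAt ℂ (fun x => (Phi p x).det) x :=
    (hasDerivAt_det (M' := Matrix.of fun m n => _)
      fun m n => hasDerivAt_Phi_sub hp hx m n).differentiableAt
  have hg : DifferentiableOn ℂ g (Metric.ball 0 1) := fun x hx =>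
    ((hdet (mem_ball_zero_iff.1 hx)).mul
      (hpow (mem_ball_zero_iff.1 hx)).differentiableAt).differentiableWithinAt
  have hg' {x : ℂ} (hx : ‖x‖ < 1) (hx0 : x ≠ 0) : deriv g x = 0 := by
    have hx1 := one_sub_ne_zero_of_norm_lt_one hx
    rw [((hasDerivAt_det_Phi hp hx hx0).fun_mul (hpow hx)).deriv, Complex.cpow_sub _ _ hx1,
      Complex.cpow_one]
    field_simp
    ring
  -- At `0`, where the system is singular, the derivative vanishes by continuity.
  have hg0 : deriv g 0 = 0 := by
    have hc : ContinuousAt (deriv g) 0 :=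
      ((hg.analyticOnNhd Metric.isOpen_ball).deriv 0 (Metric.mem_ball_self one_pos)).continuousAt
    refine tendsto_nhds_unique (hc.tendsto.mono_left nhdsWithin_le_nhds) (f := deriv g)
      (l := 𝓝[≠] 0) (tendsto_const_nhds.congr' ?_)
    filter_upwards [self_mem_nhdsWithin,
      nhdsWithin_le_nhds (Metric.ball_mem_nhds (0 : ℂ) one_pos)] with w hw hw1
    exact (hg' (mem_ball_zero_iff.1 hw1) hw).symm
  have hconst : g x = g 0 := Metric.isOpen_ball.is_const_of_deriv_eq_zero
    (convex_ball (0 : ℂ) 1).isPreconnected hg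
    (fun w hw => by
      by_cases hw0 : w = 0
      · rw [hw0, hg0, Pi.zero_apply]
      · exact hg' (mem_ball_zero_iff.1 hw) hw0)
    (mem_ball_zero_iff.2 hx) (Metric.mem_ball_self one_pos)
  intro h
  simp only [g, h, zero_mul, sub_zero, Complex.one_cpow, mul_one] at hconst
  exact det_Phi_zero_ne_zero hp hconst.symm

theorem isFundamentalSystem_Y {p : Params (N + 1)} (hp : NonResonant p) {V : Set ℂ} {lg : ℂ → ℂ}
    (hV : IsOpen V) (hVc : IsConnected V) (hVb : V ⊆ Metric.ball 0 1 \ {0})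
    (hlg : ContinuousOn lg V) (hexp : ∀ x ∈ V, Complex.exp (lg x) = x) :
    IsFundamentalSystem (coeff p) (Y p lg) V := by
  have hlg' (x) (hx : x ∈ V) : HasDerivAt lg x⁻¹ x := by
    refine HasDerivAt.of_local_left_inverse (f := Complex.exp)
      (hlg.continuousAt (hV.mem_nhds hx)) ?_ (hVb hx).2 ?_
    · simpa only [hexp x hx] using Complex.hasDerivAt_exp (lg x)
    · filter_upwards [hV.mem_nhds hx] with w hw using hexp w hw
  refine isFundamentalSystem_of_det_ne_zero hV hVc (fun n x hx => ?_) fun x hx => ?_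
  · have hx1 := mem_ball_zero_iff.1 (hVb hx).1
    have hx0 : x ≠ 0 := (hVb hx).2
    refine hasDerivAt_pi.2 fun m => ?_
    simp only [Y, Matrix.mul_diagonal]
    refine ((hasDerivAt_Phi hp hx1 hx0 m n).fun_mul
      ((hlg' x hx).const_mul (-gamma p n)).cexp).congr_deriv ?_
    simp only [Matrix.mulVec, dotProduct, ← mul_assoc]
    rw [← Finset.sum_mul, ← Matrix.mul_apply]
    field_simp
    ring
  · rw [Y, Matrix.det_mul, Matrix.det_diagonal]
    exact mul_ne_zero (det_Phi_ne_zero hp (mem_ball_zero_iff.1 (hVb hx).1))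
      (Finset.prod_ne_zero_iff.2 fun n _ => Complex.exp_ne_zero _)

end Columns

end Thomae

theorem theorem3p2 (L : ℕ) (hL : 2 ≤ L) (p : Thomae.Params L) (hp : Thomae.NonResonant p) :
    -- the integrals over the simplex: convergence, and holomorphic continuation in the parameters
    (∀ x ∈ Metric.ball (0 : ℂ) 1, ∀ j : ℤ,
      (∀ q ∈ Thomae.convergenceDomain L,
        IntegrableOn (fun t => Thomae.U q x t * Thomae.phi x j t) (Thomae.simplex L)) ∧
      Thomae.IsContinuation (L := L) x j (Thomae.eulerIntegral x j)) ∧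
    (∀ n < L, Thomae.shift n p ∈ Thomae.regularDomain L) ∧
    -- `Φ` is given by convergent power series, and is lower triangular plus `O(x)`
    (∀ m n, AnalyticOnNhd ℂ (fun x => Thomae.Phi p x m n) (Metric.ball 0 1)) ∧
    (∃ T : Matrix (Fin L) (Fin L) ℂ, (∀ m n, m < n → T m n = 0) ∧
      ∀ m n, (fun x => Thomae.Phi p x m n - T m n) =O[𝓝 0] fun x : ℂ => x) ∧
    IsUnit (Thomae.Phi p 0) ∧
    -- `Y` is a fundamental system of solutions, for every branch of the logarithm
    (∀ (V : Set ℂ) (lg : ℂ → ℂ), IsOpen V → IsConnected V → V ⊆ Metric.ball 0 1 \ {0} →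
      ContinuousOn lg V → (∀ x ∈ V, Complex.exp (lg x) = x) →
      Thomae.IsFundamentalSystem (Thomae.coeff p) (Thomae.Y p lg) V) := by
  obtain ⟨N, rfl⟩ : ∃ N, L = N + 1 := ⟨L - 1, by omega⟩
  refine ⟨fun x hx j => ⟨fun q hq => ?_, ?_⟩, fun n hn => Thomae.shift_mem_regularDomain hp hn,
    Thomae.analyticOnNhd_Phi hp, ⟨Thomae.Phi p 0, fun m n h => Thomae.Phi_zero_of_lt hp h,
      fun m n => ?_⟩, ?_, fun V lg hV hVc hVb hlg hexp =>
      Thomae.isFundamentalSystem_Y hp hV hVc hVb hlg hexp⟩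
  · exact Thomae.integrableOn_U_mul_phi hq (mem_ball_zero_iff.1 hx) j
  · exact Thomae.isContinuation_eulerIntegral (mem_ball_zero_iff.1 hx) j
  · have := (Thomae.analyticOnNhd_Phi hp m n 0 (Metric.mem_ball_self one_pos)).differentiableAt
    simpa using this.isBigO_sub
  · rw [Matrix.isUnit_iff_isUnit_det]
    exact isUnit_iff_ne_zero.2 (Thomae.det_Phi_zero_ne_zero hp)
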